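/- Let $k\in\mathbb{N}$. The multiarm scenario $A_k$ has $2k$ measurements, with finitely many possible outcomes $a_1,\ldots,a_k,x_1,\ldots,x_k$ respectively, and $k+1$ sources: for every $i$ one bipartite source connected to the measurements of $a_i$ and $x_i$, and one $k$-partite source connected to the measurements of $a_1,\ldots,a_k$. A correlation in $A_k$ is a probability distribution $p(a_1,\ldots,a_k,x_1,\ldots,x_k)$ such that, for all $i$ (a hat denotes omission), $$p(a_1,\ldots,\hat a_i,\ldots,a_k,x_1,\ldots,x_k)=p(x_i)\,p(a_1,\ldots,\hat a_i,\ldots,a_k,x_1,\ldots,\hat x_i,\ldots,x_k).$$ It is classical in $A_k$ if there are a probability space (hidden variable $\lambda_s$) for every source $s$ and, for every measurement $m$, a conditional distribution of its outcome $v_m$ given the hidden variables $\Lambda_m$ of the sources connected to $m$, such that $p(v)=\int\prod_m p(v_m|\Lambda_m)\prod_s dP(\lambda_s)$. It is quantum in $A_k$ if there are a (possibly infinite-dimensional) complex Hilbert space $\mathcal{H}_{(s,m)}$ for every connected pair of a source $s$ and a measurement $m$, a state (positive operator of unit trace) $\rho_s$ on $\bigotimes_m\mathcal{H}_{(s,m)}$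 for every source $s$, and a POVM $\{F_{m,v_m}\}_{v_m}$ on $\bigotimes_s\mathcal{H}_{(s,m)}$ for every measurement $m$, such that $p(v)=\mathrm{tr}\big[\big(\bigotimes_s\rho_s\big)\big(\bigotimes_m F_{m,v_m}\big)\big]$, where the tensor factors are reordered so as to match. A conditional distribution $c(a_1,\ldots,a_k|x_1,\ldots,x_k)$ is classical in the $k$-partite Bell scenario with settings $x_i$ and outcomes $a_i$ if there are a probability space $(\Omega,P)$ and conditional distributions $q_i(a_i|x_i,\lambda)$ with $c(a|x)=\int\prod_i q_i(a_i|x_i,\lambda)\,dP(\lambda)$. It is quantum in that Bell scenario if there are Hilbert spaces $\mathcal{H}_i$, a state $\rho$ on $\bigotimes_i\mathcal{H}_i$ and POVMs $\{A^{x_i}_{i,a_i}\}_{a_i}$ on $\mathcal{H}_i$ for each setting $x_i$ with $c(a|x)=\mathrm{tr}\big[\rho\bigotimes_iA^{x_i}_{i,a_i}\big]$. Theorem. Let $p$ be a correlation in $A_k$, and let $p(a_1,\ldots,a_k|x_1,\ldots,x_k)$ be the associated conditional distribution, defined for those values of each $x_i$ which occur with positive probability. (1) $p$ is classical in $A_k$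 if and only if $p(a_1,\ldots,a_k|x_1,\ldots,x_k)$ is classical in the $k$-partite Bell scenario. (2) $p$ is quantum in $A_k$ if and only if $p(a_1,\ldots,a_k|x_1,\ldots,x_k)$ is quantum in the $k$-partite Bell scenario. -/

import Mathlib

universe u v

set_option linter.unusedSectionVars false

open scoped TensorProduct InnerProductSpace ComplexOrder ComplexConjugate

noncomputable section

/-! ### Tensor products of finite families of Hilbert spaces -/

section HilbertTensor

variable {ι κ : Type} [Fintype ι] [Fintype κ]

/-- The algebraic tensor product of a family of complex inner product spaces. -/
def AlgTensor (H : ι → Type u) [∀ i, NormedAddCommGroup (H i)]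
    [∀ i, InnerProductSpace ℂ (H i)] : Type u :=
  ⨂[ℂ] i, H i

variable (H : ι → Type u) [∀ i, NormedAddCommGroup (H i)] [∀ i, InnerProductSpace ℂ (H i)]

namespace AlgTensor

instance : AddCommGroup (AlgTensor H) := inferInstanceAs (AddCommGroup (⨂[ℂ] i, H i))

instance : Module ℂ (AlgTensor H) := inferInstanceAs (Module ℂ (⨂[ℂ] i, H i))

/-- The simple tensor `⨂ᵢ xᵢ`. -/
def tprod : MultilinearMap ℂ H (AlgTensor H) := PiTensorProduct.tprod ℂ

variable {H}

@[elab_as_elim]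
theorem induction {H : ι → Type u} [∀ i, NormedAddCommGroup (H i)]
    [∀ i, InnerProductSpace ℂ (H i)] {motive : AlgTensor H → Prop} (z : AlgTensor H)
    (smul : ∀ (r : ℂ) (x : ∀ i, H i), motive (r • tprod H x))
    (add : ∀ a b, motive a → motive b → motive (a + b)) : motive z :=
  PiTensorProduct.induction_on (motive := motive) z smul add

/-- The multilinear functional `y ↦ ∏ᵢ ⟪xᵢ, yᵢ⟫`. -/
def innerMulti (x : ∀ i, H i) : MultilinearMap ℂ H ℂ :=
  (MultilinearMap.mkPiAlgebra ℂ ι ℂ).compLinearMap fun i => innerₛₗ ℂ (x i)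

theorem innerMulti_apply (x y : ∀ i, H i) : innerMulti x y = ∏ i, ⟪x i, y i⟫_ℂ := by
  simp [innerMulti]

theorem conj_innerMulti (x y : ∀ i, H i) : conj (innerMulti x y) = innerMulti y x := by
  simp [innerMulti_apply, map_prod]

/-- The functional `y ↦ ⟪⨂ᵢ xᵢ, y⟫`. -/
def innerLeft (x : ∀ i, H i) : AlgTensor H →ₗ[ℂ] ℂ := PiTensorProduct.lift (innerMulti x)

theorem innerLeft_tprod (x y : ∀ i, H i) : innerLeft x (tprod H y) = innerMulti x y :=
  PiTensorProduct.lift.tprod y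

/-- The antilinear functional `z ↦ ⟪z, ⨂ᵢ yᵢ⟫`. -/
def innerRight (y : ∀ i, H i) : AlgTensor H →ₗ⋆[ℂ] ℂ :=
  (starLinearEquiv ℂ : ℂ ≃ₗ⋆[ℂ] ℂ).toLinearMap.comp (innerLeft y)

theorem innerRight_tprod (x y : ∀ i, H i) : innerRight y (tprod H x) = innerMulti x y := by
  have : innerRight y (tprod H x) = conj (innerLeft y (tprod H x)) := rfl
  rw [this, innerLeft_tprod, conj_innerMulti]

theorem semilinear_ext {f g : AlgTensor H →ₗ⋆[ℂ] ℂ}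
    (h : ∀ x, f (tprod H x) = g (tprod H x)) : f = g := by
  ext z
  induction z using AlgTensor.induction with
  | smul r x => simp [h]
  | add a b ha hb => simp [ha, hb]

/-- The sesquilinear form, with the linear argument first. -/
def form : AlgTensor H →ₗ[ℂ] AlgTensor H →ₗ⋆[ℂ] ℂ :=
  PiTensorProduct.lift
    { toFun := innerRight
      map_update_add' := by
        intro _ m i x y
        refine semilinear_ext fun z => ?_
        simp only [LinearMap.add_apply, innerRight_tprod]
        exact (innerMulti z).map_update_add m i x y
      map_update_smul' := by
        intro _ m i c x
        refine semilinear_ext fun z => ?_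
        simp only [LinearMap.smul_apply, innerRight_tprod]
        exact (innerMulti z).map_update_smul m i c x }

instance : Inner ℂ (AlgTensor H) := ⟨fun x y => form y x⟩

theorem inner_def (x y : AlgTensor H) : ⟪x, y⟫_ℂ = form y x := rfl

theorem inner_tprod (x y : ∀ i, H i) : ⟪tprod H x, tprod H y⟫_ℂ = ∏ i, ⟪x i, y i⟫_ℂ := by
  rw [inner_def, ← innerMulti_apply, ← innerRight_tprod]
  exact congrArg (fun f : AlgTensor H →ₗ⋆[ℂ] ℂ => f (tprod H x))
    (PiTensorProduct.lift.tprod (φ := _) y)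

theorem aux_add_left (x y z : AlgTensor H) : ⟪x + y, z⟫_ℂ = ⟪x, z⟫_ℂ + ⟪y, z⟫_ℂ := by
  simp [inner_def]

theorem aux_add_right (x y z : AlgTensor H) : ⟪x, y + z⟫_ℂ = ⟪x, y⟫_ℂ + ⟪x, z⟫_ℂ := by
  simp [inner_def]

theorem aux_smul_left (x y : AlgTensor H) (r : ℂ) : ⟪r • x, y⟫_ℂ = conj r * ⟪x, y⟫_ℂ := by
  simp [inner_def]

theorem aux_smul_right (x y : AlgTensor H) (r : ℂ) : ⟪x, r • y⟫_ℂ = r * ⟪x, y⟫_ℂ := by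
  simp [inner_def]

theorem aux_conj (x y : AlgTensor H) : conj ⟪y, x⟫_ℂ = ⟪x, y⟫_ℂ := by
  induction x using AlgTensor.induction with
  | smul r x =>
    induction y using AlgTensor.induction with
    | smul s y =>
      simp only [aux_smul_left, aux_smul_right, inner_tprod, map_mul, map_prod, inner_conj_symm,
        Complex.conj_conj]
      ring
    | add a b ha hb => simp only [aux_add_left, aux_add_right, map_add, ha, hb]
  | add a b ha hb => simp only [aux_add_left, aux_add_right, map_add, ha, hb]

theorem exists_eq_sum (z : AlgTensor H) :
    ∃ (n : ℕ) (c : Fin n → ℂ) (x : Fin n → ∀ i, H i), z = ∑ a, c a • tprod H (x a) := by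
  induction z using AlgTensor.induction with
  | smul r x => exact ⟨1, fun _ => r, fun _ => x, by simp⟩
  | add a b ha hb =>
    obtain ⟨n, c, x, rfl⟩ := ha
    obtain ⟨m, d, y, rfl⟩ := hb
    refine ⟨n + m, Fin.append c d, Fin.append x y, ?_⟩
    simp [Fin.sum_univ_add]

theorem inner_sum_sum {n : ℕ} (c : Fin n → ℂ) (x : Fin n → ∀ i, H i) :
    ⟪∑ a, c a • tprod H (x a), ∑ a, c a • tprod H (x a)⟫_ℂ =
      star c ⬝ᵥ (Matrix.of fun a b => ∏ i, ⟪x a i, x b i⟫_ℂ).mulVec c := by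
  simp only [inner_def, map_sum, LinearMap.sum_apply, map_smul, LinearMap.smul_apply,
    LinearMap.map_smulₛₗ]
  simp only [← inner_def, inner_tprod, dotProduct, Matrix.mulVec, Matrix.of_apply,
    Pi.star_apply, Finset.mul_sum, smul_eq_mul]
  refine Finset.sum_congr rfl fun a _ => Finset.sum_congr rfl fun b _ => ?_
  simp only [starRingEnd_apply]
  ring

/-- Entrywise products of positive semidefinite matrices respect the Loewner order. -/
theorem posSemidef_prod {𝕜 : Type*} [RCLike 𝕜] {n : ℕ} (s : Finset ι)
    (A B : ι → Matrix (Fin n) (Fin n) 𝕜)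
    (hA : ∀ i, (A i).PosSemidef) (hB : ∀ i, (B i - A i).PosSemidef) :
    (Matrix.of fun a b => ∏ i ∈ s, A i a b).PosSemidef ∧
      ((Matrix.of fun a b => ∏ i ∈ s, B i a b) -
        Matrix.of fun a b => ∏ i ∈ s, A i a b).PosSemidef := by
  classical
  induction s using Finset.induction_on with
  | empty =>
    refine ⟨?_, by simpa using Matrix.PosSemidef.zero⟩
    have h : (Matrix.of fun a b => ∏ i ∈ (∅ : Finset ι), A i a b) =
        Matrix.gram 𝕜 (fun _ : Fin n => (1 : 𝕜)) := by
      ext a b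
      simp [Matrix.gram_apply]
    rw [h]
    exact Matrix.posSemidef_gram _ _
  | insert i s hi ih =>
    obtain ⟨h1, h2⟩ := ih
    have hBi : (B i).PosSemidef := by simpa using (hB i).add (hA i)
    refine ⟨?_, ?_⟩
    · have h : (Matrix.of fun a b => ∏ j ∈ insert i s, A j a b) =
          (A i).hadamard (Matrix.of fun a b => ∏ j ∈ s, A j a b) := by
        ext a b
        simp [Finset.prod_insert hi]
      rw [h]
      exact (hA i).hadamard h1
    · have h : ((Matrix.of fun a b => ∏ j ∈ insert i s, B j a b) -
          Matrix.of fun a b => ∏ j ∈ insert i s, A j a b) =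
          (B i).hadamard ((Matrix.of fun a b => ∏ j ∈ s, B j a b) -
            Matrix.of fun a b => ∏ j ∈ s, A j a b) +
          (B i - A i).hadamard (Matrix.of fun a b => ∏ j ∈ s, A j a b) := by
        ext a b
        simp [Finset.prod_insert hi]
        ring
      rw [h]
      exact (hBi.hadamard h2).add ((hB i).hadamard h1)

theorem aux_nonneg (x : AlgTensor H) : 0 ≤ RCLike.re ⟪x, x⟫_ℂ := by
  obtain ⟨n, c, x, rfl⟩ := exists_eq_sum x
  rw [inner_sum_sum]
  have h := (posSemidef_prod (𝕜 := ℂ) Finset.univ (fun i => Matrix.gram ℂ fun a => x a i)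
    (fun i => Matrix.gram ℂ fun a => x a i) (fun i => Matrix.posSemidef_gram _ _)
    (fun i => by rw [sub_self]; exact Matrix.PosSemidef.zero)).1
  exact (RCLike.nonneg_iff.1 (h.dotProduct_mulVec_nonneg c)).1

variable (H) in
/-- The inner product determined by `⟪⨂ᵢ xᵢ, ⨂ᵢ yᵢ⟫ = ∏ᵢ ⟪xᵢ, yᵢ⟫`. -/
abbrev core : PreInnerProductSpace.Core ℂ (AlgTensor H) where
  inner x y := ⟪x, y⟫_ℂ
  conj_inner_symm := aux_conj
  re_inner_nonneg := aux_nonneg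
  add_left := aux_add_left
  smul_left := aux_smul_left

instance : SeminormedAddCommGroup (AlgTensor H) :=
  @InnerProductSpace.Core.toSeminormedAddCommGroup ℂ (AlgTensor H) _ _ _ (core H)

instance : InnerProductSpace ℂ (AlgTensor H) := InnerProductSpace.ofCore (core H)

theorem re_inner_sum_sum {n : ℕ} (c : Fin n → ℂ) (x : Fin n → ∀ i, H i) :
    ‖∑ a, c a • tprod H (x a)‖ ^ 2 =
      RCLike.re (star c ⬝ᵥ (Matrix.of fun a b => ∏ i, ⟪x a i, x b i⟫_ℂ).mulVec c) := by
  rw [← inner_sum_sum]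
  exact norm_sq_eq_re_inner (𝕜 := ℂ) _

variable {G : ι → Type u} [∀ i, NormedAddCommGroup (G i)] [∀ i, InnerProductSpace ℂ (G i)]

/-- The tensor product of linear maps on the algebraic tensor product. -/
def map (T : ∀ i, H i →L[ℂ] G i) : AlgTensor H →ₗ[ℂ] AlgTensor G :=
  PiTensorProduct.map fun i => (T i : H i →ₗ[ℂ] G i)

theorem map_tprod (T : ∀ i, H i →L[ℂ] G i) (x : ∀ i, H i) :
    map T (tprod H x) = tprod G fun i => T i (x i) :=
  PiTensorProduct.map_tprod (fun i => (T i : H i →ₗ[ℂ] G i)) x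

theorem norm_map_le (T : ∀ i, H i →L[ℂ] G i) (z : AlgTensor H) :
    ‖map T z‖ ≤ (∏ i, ‖T i‖) * ‖z‖ := by
  obtain ⟨n, c, x, rfl⟩ := exists_eq_sum z
  have hT : map T (∑ a, c a • tprod H (x a)) =
      ∑ a, c a • tprod G fun i => T i (x a i) := by
    simp [map_tprod]
  refine (sq_le_sq₀ (norm_nonneg _) (by positivity)).1 ?_
  rw [hT, mul_pow, re_inner_sum_sum, re_inner_sum_sum]
  have h := (posSemidef_prod (𝕜 := ℂ) Finset.univ
    (fun i => Matrix.gram ℂ ((T i : H i → G i) ∘ fun a => x a i))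
    (fun i => (‖T i‖ ^ 2) • Matrix.gram ℂ fun a => x a i)
    (fun i => Matrix.posSemidef_gram _ _)
    (fun i => Matrix.posSemidef_opNorm_smul_gram_sub_gram _ _)).2
  have h' := (RCLike.nonneg_iff.1 (h.dotProduct_mulVec_nonneg c)).1
  have e : (Matrix.of fun a b => ∏ i, ((‖T i‖ ^ 2) • Matrix.gram ℂ fun a => x a i) a b) =
      ((∏ i, ‖T i‖) ^ 2) • (Matrix.of fun a b => ∏ i, ⟪x a i, x b i⟫_ℂ) := by
    ext a b
    simp [Matrix.gram_apply, Finset.prod_mul_distrib, Finset.prod_pow]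
  rw [e, Matrix.sub_mulVec, dotProduct_sub, Matrix.smul_mulVec, dotProduct_smul, map_sub,
    RCLike.smul_re, sub_nonneg] at h'
  exact h'

end AlgTensor

/-- The Hilbert space tensor product of a finite family of Hilbert spaces: the completion of the
algebraic tensor product for the inner product `⟪⨂ᵢ xᵢ, ⨂ᵢ yᵢ⟫ = ∏ᵢ ⟪xᵢ, yᵢ⟫`. -/
abbrev HilbertTensor : Type u := UniformSpace.Completion (AlgTensor H)

namespace HilbertTensor

/-- The simple tensor `⨂ᵢ xᵢ` in the Hilbert space tensor product. -/
def tprod : MultilinearMap ℂ H (HilbertTensor H) :=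
  (UniformSpace.Completion.toComplL (𝕜 := ℂ) (E := AlgTensor H)).toLinearMap.compMultilinearMap
    (AlgTensor.tprod H)

variable {H}

theorem tprod_eq_coe (x : ∀ i, H i) :
    tprod H x = ((AlgTensor.tprod H x : AlgTensor H) : HilbertTensor H) := rfl

theorem inner_tprod (x y : ∀ i, H i) : ⟪tprod H x, tprod H y⟫_ℂ = ∏ i, ⟪x i, y i⟫_ℂ := by
  rw [tprod_eq_coe, tprod_eq_coe, UniformSpace.Completion.inner_coe]
  exact AlgTensor.inner_tprod x y

/-- Bounded operators which agree on simple tensors are equal. -/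
theorem ext {E : Type*} [NormedAddCommGroup E] [NormedSpace ℂ E]
    {S T : HilbertTensor H →L[ℂ] E} (h : ∀ x, S (tprod H x) = T (tprod H x)) : S = T := by
  ext z
  induction z using UniformSpace.Completion.induction_on with
  | hp => exact isClosed_eq S.continuous T.continuous
  | ih z =>
    induction z using AlgTensor.induction with
    | smul r x =>
      have := h x
      rw [tprod_eq_coe] at this
      simp only [UniformSpace.Completion.coe_smul, map_smul, this]
    | add a b ha hb => simp only [UniformSpace.Completion.coe_add, map_add, ha, hb]

variable {G : ι → Type u} [∀ i, NormedAddCommGroup (G i)] [∀ i, InnerProductSpace ℂ (G i)]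

/-- The tensor product `⨂ᵢ Tᵢ` of bounded operators. -/
def map (T : ∀ i, H i →L[ℂ] G i) : HilbertTensor H →L[ℂ] HilbertTensor G :=
  ((AlgTensor.map T).mkContinuous (∏ i, ‖T i‖) (AlgTensor.norm_map_le T)).completion

theorem map_tprod (T : ∀ i, H i →L[ℂ] G i) (x : ∀ i, H i) :
    map T (tprod H x) = tprod G fun i => T i (x i) := by
  rw [tprod_eq_coe, tprod_eq_coe, map, ContinuousLinearMap.completion_apply_coe]
  simp [AlgTensor.map_tprod]

/-! #### Grouping the factors of a tensor product

Given `f : ι → κ`, the space `⨂ᵢ Hᵢ` is canonically identified with `⨂ₖ ⨂_{f i = k} Hᵢ`. -/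

/-- The tensor product of the factors `H i` with `f i = k`. -/
abbrev Block (H : ι → Type u) [∀ i, NormedAddCommGroup (H i)] [∀ i, InnerProductSpace ℂ (H i)]
    [DecidableEq κ] (f : ι → κ) (k : κ) : Type u :=
  HilbertTensor fun i : {i // f i = k} => H i.1

variable [DecidableEq κ] (f : ι → κ)

theorem block_update [DecidableEq ι] (m : ∀ i, H i) (i : ι) (z : H i) :
    (fun k => tprod (fun j : {j // f j = k} => H j.1) fun j => Function.update m i z j.1) =
      Function.update (fun k => tprod (fun j : {j // f j = k} => H j.1) fun j => m j.1) (f i)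
        (tprod (fun j : {j // f j = f i} => H j.1)
          (Function.update (fun j : {j // f j = f i} => m j.1) ⟨i, rfl⟩ z)) := by
  funext k
  by_cases hk : k = f i
  · subst hk
    rw [Function.update_self]
    congr 1
    funext j
    by_cases hj : j = ⟨i, rfl⟩
    · subst hj
      simp
    · have hj' : j.1 ≠ i := fun h => hj (Subtype.ext h)
      simp [Function.update_of_ne hj, Function.update_of_ne hj']
  · rw [Function.update_of_ne hk]
    congr 1
    funext j
    have hj' : j.1 ≠ i := fun h => hk (by rw [← j.2, h])
    simp [Function.update_of_ne hj']

/-- The map `(xᵢ)ᵢ ↦ ⨂ₖ ⨂_{f i = k} xᵢ`. -/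
def groupMulti : MultilinearMap ℂ H (HilbertTensor (Block H f)) where
  toFun x := tprod (Block H f) fun k => tprod (fun i : {i // f i = k} => H i.1) fun i => x i.1
  map_update_add' := by
    intro hdec m i x y
    have : hdec = Classical.decEq ι := Subsingleton.elim _ _
    subst this
    let _ := Classical.decEq ι
    rw [block_update, block_update, block_update, MultilinearMap.map_update_add,
      MultilinearMap.map_update_add]
  map_update_smul' := by
    intro hdec m i c x
    have : hdec = Classical.decEq ι := Subsingleton.elim _ _
    subst this
    let _ := Classical.decEq ι
    rw [block_update, block_update, MultilinearMap.map_update_smul,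
      MultilinearMap.map_update_smul]

theorem inner_groupMulti (x y : ∀ i, H i) :
    ⟪groupMulti f x, groupMulti f y⟫_ℂ = ∏ i, ⟪x i, y i⟫_ℂ := by
  have h := inner_tprod (H := Block H f)
    (fun k => tprod (fun i : {i // f i = k} => H i.1) fun i => x i.1)
    (fun k => tprod (fun i : {i // f i = k} => H i.1) fun i => y i.1)
  refine h.trans ?_
  simp only [inner_tprod]
  exact Fintype.prod_fiberwise f fun i => ⟪x i, y i⟫_ℂ

/-- The linear extension of `groupMulti` to the algebraic tensor product. -/
def groupAlg : AlgTensor H →ₗ[ℂ] HilbertTensor (Block H f) :=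
  PiTensorProduct.lift (groupMulti f)

theorem groupAlg_tprod (x : ∀ i, H i) : groupAlg f (AlgTensor.tprod H x) = groupMulti f x :=
  PiTensorProduct.lift.tprod x

theorem inner_groupAlg (x y : AlgTensor H) : ⟪groupAlg f x, groupAlg f y⟫_ℂ = ⟪x, y⟫_ℂ := by
  induction x using AlgTensor.induction with
  | smul r x =>
    induction y using AlgTensor.induction with
    | smul s y =>
      simp only [map_smul, inner_smul_left, inner_smul_right, groupAlg_tprod, inner_groupMulti]
      rw [AlgTensor.inner_tprod]
    | add a b ha hb => simp only [map_add, inner_add_right, ha, hb]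
  | add a b ha hb => simp only [map_add, inner_add_left, ha, hb]

/-- The canonical unitary `⨂ᵢ Hᵢ → ⨂ₖ ⨂_{f i = k} Hᵢ`. -/
def group : HilbertTensor H →L[ℂ] HilbertTensor (Block H f) :=
  ((groupAlg f).mkContinuous 1 fun z => by
    have h : ‖groupAlg f z‖ ^ 2 = ‖z‖ ^ 2 := by
      rw [norm_sq_eq_re_inner (𝕜 := ℂ), norm_sq_eq_re_inner (𝕜 := ℂ), inner_groupAlg]
    rw [one_mul]
    exact ((sq_eq_sq₀ (norm_nonneg _) (norm_nonneg _)).1 h).le).fromCompletion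

theorem group_tprod (x : ∀ i, H i) :
    group f (tprod H x) =
      tprod (Block H f) fun k => tprod (fun i : {i // f i = k} => H i.1) fun i => x i.1 := by
  rw [tprod_eq_coe, group, ContinuousLinearMap.fromCompletion_apply_coe]
  exact groupAlg_tprod f x

/-- Given operators `T k` on `⨂_{f i = k} Hᵢ`, the operator `⨂ₖ T k` regarded as an operator on
`⨂ᵢ Hᵢ` by reordering the factors. -/
def groupMap (T : ∀ k, Block H f k →L[ℂ] Block H f k) : HilbertTensor H →L[ℂ] HilbertTensor H :=
  (group f).adjoint ∘L map T ∘L group f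

/-- The matrix elements of the reordered tensor product operator between simple tensors. -/
theorem inner_groupMap (T : ∀ k, Block H f k →L[ℂ] Block H f k) (x y : ∀ i, H i) :
    ⟪tprod H x, groupMap f T (tprod H y)⟫_ℂ =
      ∏ k, ⟪tprod (fun i : {i // f i = k} => H i.1) fun i => x i.1,
        T k (tprod (fun i : {i // f i = k} => H i.1) fun i => y i.1)⟫_ℂ := by
  rw [groupMap, ContinuousLinearMap.comp_apply, ContinuousLinearMap.adjoint_inner_right,
    ContinuousLinearMap.comp_apply, group_tprod, group_tprod, map_tprod, inner_tprod]

end HilbertTensor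

end HilbertTensor

/-! ### States, measurements and the trace -/

section Quantum

variable (K : Type u) [NormedAddCommGroup K] [InnerProductSpace ℂ K] [CompleteSpace K]

/-- The index set of a chosen orthonormal basis of a Hilbert space. -/
def onbIndex : Set K := (exists_hilbertBasis ℂ K).choose

/-- A chosen orthonormal basis of a Hilbert space. -/
def onb : HilbertBasis (onbIndex K) ℂ K := (exists_hilbertBasis ℂ K).choose_spec.choose

variable {K}

/-- The trace. For trace-class operators the series converges absolutely and its value does not
depend on the orthonormal basis. -/
def opTrace (T : K →L[ℂ] K) : ℂ := ∑' i, ⟪onb K i, T (onb K i)⟫_ℂ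

/-- Quantum states: positive trace-class operators of unit trace. (A positive operator is
trace-class if and only if the series of its diagonal entries converges in some, equivalently every,
orthonormal basis.) -/
def IsState (ρ : K →L[ℂ] K) : Prop :=
  ρ.IsPositive ∧ HasSum (fun i => ⟪onb K i, ρ (onb K i)⟫_ℂ) 1

/-- POVMs with a finite set of outcomes. -/
def IsPOVM {O : Type v} [Fintype O] (F : O → K →L[ℂ] K) : Prop :=
  (∀ o, (F o).IsPositive) ∧ ∑ o, F o = 1

end Quantum

/-- `q o ω` is a distribution of the outcome `o` conditional on the hidden variable `ω`, that is, a
POVM in the bounded measurable functions. -/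
def IsCondDist {Ω : Type u} [MeasurableSpace Ω] {O : Type v} [Fintype O] (q : O → Ω → ℝ) : Prop :=
  (∀ o, Measurable (q o)) ∧ (∀ o ω, 0 ≤ q o ω) ∧ ∀ ω, ∑ o, q o ω = 1

/-! ### Correlation scenarios -/

/-- A correlation scenario: finitely many sources and measurements, and the relation specifying
which source connects to which measurement. -/
structure CorrelationScenario where
  Source : Type
  Meas : Type
  [fintypeSource : Fintype Source]
  [decEqSource : DecidableEq Source]
  [fintypeMeas : Fintype Meas]
  [decEqMeas : DecidableEq Meas]
  connects : Source → Meas → Prop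
  [decConnects : ∀ s m, Decidable (connects s m)]

namespace CorrelationScenario

attribute [instance] fintypeSource decEqSource fintypeMeas decEqMeas decConnects

variable (G : CorrelationScenario)

/-- The connections between sources and measurements. -/
abbrev Conn : Type := {c : G.Source × G.Meas // G.connects c.1 c.2}

/-- The source of a connection. -/
abbrev Conn.src (c : G.Conn) : G.Source := c.1.1

/-- The measurement of a connection. -/
abbrev Conn.meas (c : G.Conn) : G.Meas := c.1.2

variable {out : G.Meas → Type v} [∀ m, Fintype (out m)]

/-- `p` is classical in the scenario `G`: each source `s` emits an independent hidden variable
`Ω s`, and each outcome is a probabilistic function of the hidden variables of the sources connected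
to the measurement. -/
def IsClassical (p : (∀ m, out m) → ℝ) : Prop :=
  ∃ (Ω : G.Source → Type u) (_ : ∀ s, MeasurableSpace (Ω s))
    (P : ∀ s, MeasureTheory.Measure (Ω s)) (_ : ∀ s, MeasureTheory.IsProbabilityMeasure (P s))
    (q : ∀ m, out m → (∀ s : {s // G.connects s m}, Ω s.1) → ℝ),
    (∀ m, IsCondDist (q m)) ∧
    ∀ v, p v = ∫ ω, ∏ m, q m (v m) (fun s => ω s.1) ∂(MeasureTheory.Measure.pi P)

/-- `p` is quantum in the scenario `G`: there are a Hilbert space for each connection, a state `ρ s`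
of the systems emitted by each source `s`, and a POVM `F m` on the systems received by each
measurement `m`, which reproduce `p` via `tr[(⨂ₛ ρ s)(⨂ₘ F m (v m))]`. -/
def IsQuantum (p : (∀ m, out m) → ℝ) : Prop :=
  ∃ (H : G.Conn → Type u) (_ : ∀ c, NormedAddCommGroup (H c))
    (_ : ∀ c, InnerProductSpace ℂ (H c)) (_ : ∀ c, CompleteSpace (H c))
    (ρ : ∀ s, HilbertTensor.Block H (Conn.src G) s →L[ℂ] HilbertTensor.Block H (Conn.src G) s)
    (F : ∀ m, out m →
      HilbertTensor.Block H (Conn.meas G) m →L[ℂ] HilbertTensor.Block H (Conn.meas G) m),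
    (∀ s, IsState (ρ s)) ∧ (∀ m, IsPOVM (F m)) ∧
    ∀ v, (p v : ℂ) = opTrace (HilbertTensor.groupMap (Conn.src G) ρ ∘L
      HilbertTensor.groupMap (Conn.meas G) fun m => F m (v m))

end CorrelationScenario

/-! ### Bell scenarios -/

section Bell

variable {k : ℕ} {X A : Fin k → Type v} [∀ i, Fintype (A i)]

/-- A conditional distribution `c x a = c(a₁,…,aₖ|x₁,…,xₖ)` is classical in the `k`-partite Bell
scenario with settings `xᵢ` and outcomes `aᵢ`: it has a local hidden variable model. -/
def IsBellClassical (c : (∀ i, X i) → (∀ i, A i) → ℝ) : Prop :=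
  ∃ (Ω : Type u) (_ : MeasurableSpace Ω) (P : MeasureTheory.Measure Ω)
    (_ : MeasureTheory.IsProbabilityMeasure P) (q : ∀ i, X i → A i → Ω → ℝ),
    (∀ i x, IsCondDist (q i x)) ∧
    ∀ x a, c x a = ∫ ω, ∏ i, q i (x i) (a i) ω ∂P

/-- A conditional distribution is quantum in the `k`-partite Bell scenario: it arises from local
measurements on a `k`-partite quantum state. -/
def IsBellQuantum (c : (∀ i, X i) → (∀ i, A i) → ℝ) : Prop :=
  ∃ (H : Fin k → Type u) (_ : ∀ i, NormedAddCommGroup (H i))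
    (_ : ∀ i, InnerProductSpace ℂ (H i)) (_ : ∀ i, CompleteSpace (H i))
    (ρ : HilbertTensor H →L[ℂ] HilbertTensor H) (F : ∀ i, X i → A i → H i →L[ℂ] H i),
    IsState ρ ∧ (∀ i x, IsPOVM (F i x)) ∧
    ∀ x a, (c x a : ℂ) = opTrace (ρ ∘L HilbertTensor.map fun i => F i (x i) (a i))

end Bell

/-! ### Multiarm scenarios -/

/-- The multiarm scenario with `k` arms. The measurement `inl i` has outcome `aᵢ` and `inr i` has
outcome `xᵢ`. The source `none` connects to all the `inl i`, and the source `some i` connects to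
`inl i` and `inr i`. -/
abbrev multiarm (k : ℕ) : CorrelationScenario where
  Source := Option (Fin k)
  Meas := Fin k ⊕ Fin k
  connects
    | none, .inl _ => True
    | none, .inr _ => False
    | some i, .inl j => i = j
    | some i, .inr j => i = j
  decConnects
    | none, .inl _ => inferInstanceAs (Decidable True)
    | none, .inr _ => inferInstanceAs (Decidable False)
    | some i, .inl j => inferInstanceAs (Decidable (i = j))
    | some i, .inr j => inferInstanceAs (Decidable (i = j))

section Multiarm

variable {M : Type} [Fintype M] [DecidableEq M] {out : M → Type v} [∀ m, Fintype (out m)]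

open scoped Classical in
/-- The marginal distribution of `p` for the measurements in `U`, evaluated at the outcomes
`(v m)_{m ∈ U}`. -/
def marginal (p : (∀ m, out m) → ℝ) (U : Set M) (v : ∀ m, out m) : ℝ :=
  ∑ w, if ∀ m ∈ U, w m = v m then p w else 0

variable {k : ℕ} {out : Fin k ⊕ Fin k → Type v} [∀ m, Fintype (out m)]

/-- Correlations in the multiarm scenario: probability distributions `p(a₁,…,aₖ,x₁,…,xₖ)` such that
`p(a₁,…,âᵢ,…,aₖ,x₁,…,xₖ) = p(xᵢ) p(a₁,…,âᵢ,…,aₖ,x₁,…,x̂ᵢ,…,xₖ)` for all `i`. -/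
def IsMultiarmCorrelation (p : (∀ m, out m) → ℝ) : Prop :=
  (∀ v, 0 ≤ p v) ∧ ∑ v, p v = 1 ∧
    ∀ (i : Fin k) (v : ∀ m, out m),
      marginal p {.inl i}ᶜ v = marginal p {.inr i} v * marginal p {.inl i, .inr i}ᶜ v

open scoped Classical in
/-- The probability `p(xᵢ)` of an outcome `xᵢ`. -/
def settingProb (p : (∀ m, out m) → ℝ) (i : Fin k) (x : out (.inr i)) : ℝ :=
  ∑ w, if w (.inr i) = x then p w else 0

/-- The outcomes `xᵢ` which occur with positive probability. -/
abbrev PosSetting (p : (∀ m, out m) → ℝ) (i : Fin k) : Type v :=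
  {x : out (.inr i) // 0 < settingProb p i x}

/-- The joint outcome `(a₁,…,aₖ,x₁,…,xₖ)`. -/
def joint (a : ∀ i, out (.inl i)) (x : ∀ i, out (.inr i)) : ∀ m, out m
  | .inl i => a i
  | .inr i => x i

/-- The conditional distribution `p(a₁,…,aₖ|x₁,…,xₖ) = p(a₁,…,aₖ,x₁,…,xₖ) / p(x₁,…,xₖ)`, for
those values of the `xᵢ` which occur with positive probability. -/
def settingCond (p : (∀ m, out m) → ℝ) (x : ∀ i, PosSetting p i) (a : ∀ i, out (.inl i)) : ℝ :=
  p (joint a fun i => (x i).1) / ∑ a' : (∀ i, out (.inl i)), p (joint a' fun i => (x i).1)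

end Multiarm

end

noncomputable section

/-! ### Sums over product index types -/

/-! Summing the defining identity for arm `i` over further outcomes shows that `xᵢ` is independent
of the other settings, so `p(x) = ∏ᵢ p(xᵢ)` and `p(a,x) = ∏ᵢ p(xᵢ) · p(a|x)` wherever all settings
have positive probability (`marginal_image`, `eq_prod_mul_settingCond`); elsewhere `p` vanishes.

From a Bell model to a multiarm model: the source of arm `i` draws `x` with probability `p(xᵢ = x)`
and sends a copy to both of its measurements. One announces `x`, the other performs the Bell
measurement with setting `x`. In the quantum case the copy is the state `∑ₓ p(xᵢ = x) |xx⟩⟨xx|`,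
read off in the basis (`opTrace_bell`).

From a multiarm model to a Bell model: the source of arm `i` touches nothing outside that arm, so it
can be averaged out. What is left on the central source is, for each `x` and `a`, a nonnegative
function or positive operator `Bᵢ(x,a)`. Summing over `a` discards the measurement of `aᵢ`; the
measurement of `xᵢ` does not see the central source, so the sum is a constant `Nᵢ(x)`, respectively
that multiple of the identity (`exists_responses`, `inner_sum_armOp`). Hence `p(x) = ∏ᵢ Nᵢ(xᵢ)`, the
constants are nonzero at settings of positive probability (`factor_ne_zero`), and `Bᵢ(x,a) / Nᵢ(x)`
is a local response or POVM reproducing `p(a|x)`. There is no need to identify `Nᵢ(x)` with `p(xᵢ =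
x)`: only the products are compared.

In infinite dimensions the trace is handled by writing every state as `∑ₙ |ξₙ⟩⟨ξₙ|` with `∑ₙ ‖ξₙ‖² <
∞`, so that `tr(ρT) = ∑ₙ ⟪ξₙ, T ξₙ⟫` converges absolutely (`IsEnsemble.hasSum_opTrace`). Averaging
out the arm sources then becomes a rearrangement of absolutely convergent series, and the reordering
of tensor factors is checked on simple tensors and extended by multilinearity and continuity
(`regroup_tprod`, `opTrace_eq`). -/

theorem hasSum_pi_prod_option {ι : Type} [Fintype ι] {α : Option ι → Type u}
    (f : ∀ i, α i → ℂ) (a : Option ι → ℂ)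
    (h0 : HasSum (f none) (a none)) (h0' : Summable fun n => ‖f none n‖)
    (h1 : HasSum (fun n : ∀ i, α (some i) => ∏ i, f (some i) (n i)) (∏ i, a (some i)))
    (h2 : Summable fun n : ∀ i, α (some i) => ‖∏ i, f (some i) (n i)‖) :
    HasSum (fun n : ∀ i, α i => ∏ i, f i (n i)) (∏ i, a i) ∧
      Summable fun n : ∀ i, α i => ‖∏ i, f i (n i)‖ := by
  have key := summable_mul_of_summable_norm' h0' h0.summable h2 h1.summable
  have key' := h0'.mul_of_nonneg h2 (fun _ => norm_nonneg _) fun _ => norm_nonneg _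
  have h3 := h0.mul h1 key
  let e : (∀ i, α i) ≃ α none × ∀ i, α (some i) := Equiv.piOptionEquivProd
  have h4 := e.hasSum_iff.2 h3
  have h5 := e.summable_iff.2 key'
  refine ⟨?_, ?_⟩
  · rw [Fintype.prod_option]
    refine h4.congr_fun fun n => ?_
    rw [Fintype.prod_option]
    rfl
  · refine h5.congr fun n => ?_
    rw [Fintype.prod_option, norm_mul]
    rfl

theorem hasSum_pi_prod_equiv {ι κ : Type} [Fintype ι] [Fintype κ] (e : ι ≃ κ) {α : κ → Type u}
    (f : ∀ i, α i → ℂ) (a : κ → ℂ)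
    (h1 : HasSum (fun n : ∀ i, α (e i) => ∏ i, f (e i) (n i)) (∏ i, a (e i)))
    (h2 : Summable fun n : ∀ i, α (e i) => ‖∏ i, f (e i) (n i)‖) :
    HasSum (fun n : ∀ i, α i => ∏ i, f i (n i)) (∏ i, a i) ∧
      Summable fun n : ∀ i, α i => ‖∏ i, f i (n i)‖ := by
  let e' : (∀ i, α i) ≃ ∀ i, α (e i) := (Equiv.piCongrLeft α e).symm
  have he (n : ∀ i, α i) : ∏ i, f (e i) (e' n i) = ∏ i, f i (n i) :=
    Equiv.prod_comp e fun i => f i (n i)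
  have h4 := e'.hasSum_iff.2 h1
  have h5 := e'.summable_iff.2 h2
  rw [Equiv.prod_comp e a] at h4
  exact ⟨h4.congr_fun fun n => (he n).symm, h5.congr fun n => by rw [← he n]; rfl⟩

/-- Cauchy products of absolutely convergent series, by induction on the finite index type. Absolute
convergence is carried along because the next factor needs it. -/
theorem hasSum_pi_prod {ι : Type} [Fintype ι] {α : ι → Type u} (f : ∀ i, α i → ℂ) (a : ι → ℂ)
    (hf : ∀ i, HasSum (f i) (a i)) (hf' : ∀ i, Summable fun n => ‖f i n‖) :
    HasSum (fun n : ∀ i, α i => ∏ i, f i (n i)) (∏ i, a i) ∧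
      Summable fun n : ∀ i, α i => ‖∏ i, f i (n i)‖ := by
  classical
  let P : ∀ (ι : Type) [Fintype ι], Prop := fun ι _ => ∀ (α : ι → Type u) (f : ∀ i, α i → ℂ)
    (a : ι → ℂ), (∀ i, HasSum (f i) (a i)) → (∀ i, Summable fun n => ‖f i n‖) →
    HasSum (fun n : ∀ i, α i => ∏ i, f i (n i)) (∏ i, a i) ∧
      Summable fun n : ∀ i, α i => ‖∏ i, f i (n i)‖
  have hP : P ι := by
    refine Fintype.induction_empty_option (P := P) ?_ ?_ ?_ ι
    · intro ι κ _ e ih α f a hf hf'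
      let _ := Fintype.ofEquiv κ e.symm
      have h := ih (fun i => α (e i)) (fun i => f (e i)) (fun i => a (e i)) (fun i => hf _)
        fun i => hf' _
      exact hasSum_pi_prod_equiv e f a h.1 h.2
    · intro α f a _ _
      refine ⟨?_, (hasSum_unique _).summable⟩
      simp
    · intro ι _ ih α f a hf hf'
      have h := ih (fun i => α (some i)) (fun i => f (some i)) (fun i => a (some i))
        (fun i => hf _) fun i => hf' _
      exact hasSum_pi_prod_option f a (hf none) (hf' none) h.1 h.2
  exact hP α f a hf hf'

/-! ### Ensembles of vectors representing positive trace-class operators -/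

section Ensemble

variable {K K' : Type u} [NormedAddCommGroup K] [InnerProductSpace ℂ K] [CompleteSpace K]
  [NormedAddCommGroup K'] [InnerProductSpace ℂ K'] [CompleteSpace K']
  {ι : Type*}

open InnerProductSpace

/-- `ρ = ∑ₙ |ξₙ⟩⟨ξₙ|` with `∑ₙ ‖ξₙ‖² < ∞`. -/
structure IsEnsemble (ρ : K →L[ℂ] K) (ξ : ι → K) : Prop where
  summable : Summable fun n => ‖ξ n‖ ^ 2
  hasSum : HasSum (fun n => rankOne ℂ (ξ n) (ξ n)) ρ

theorem ContinuousLinearMap.hasSum_inner {T : K →L[ℂ] K'} {S : ι → K →L[ℂ] K'} (h : HasSum S T)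
    (x : K') (y : K) : HasSum (fun n => ⟪x, S n y⟫_ℂ) ⟪x, T y⟫_ℂ := by
  have h1 := h.mapL (ContinuousLinearMap.apply ℂ K' y)
  exact h1.mapL (innerSL ℂ x)

/-- Over `ℂ` a quadratic form with real values comes from a symmetric operator, so symmetry need not
be assumed. -/
theorem isPositive_of_inner_nonneg {T : K →L[ℂ] K} (h : ∀ x, 0 ≤ ⟪x, T x⟫_ℂ) : T.IsPositive := by
  rw [ContinuousLinearMap.isPositive_iff_complex]
  intro x
  have h1 := h x
  rw [← inner_conj_symm, Complex.nonneg_iff] at h1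
  simp only [Complex.conj_re, Complex.conj_im] at h1
  refine ⟨?_, h1.1⟩
  refine Complex.ext rfl ?_
  simp [h1.2] 
  linarith [h1.2]

theorem isPositive_of_hasSum {T : K →L[ℂ] K} {S : ι → K →L[ℂ] K} (h : HasSum S T)
    (hS : ∀ n, (S n).IsPositive) : T.IsPositive :=
  isPositive_of_inner_nonneg fun x => (ContinuousLinearMap.hasSum_inner h x x).nonneg
    fun n => (hS n).inner_nonneg_right x

theorem summable_norm_sq_map {ξ : ι → K} (h : Summable fun n => ‖ξ n‖ ^ 2) (S : K →L[ℂ] K') :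
    Summable fun n => ‖S (ξ n)‖ ^ 2 := by
  refine Summable.of_nonneg_of_le (fun _ => by positivity) (fun n => ?_) (h.mul_left (‖S‖ ^ 2))
  rw [← mul_pow]
  gcongr
  exact S.le_opNorm _

theorem HilbertBasis.hasSum_norm_sq {J : Type*} (b : HilbertBasis J ℂ K) (x : K) :
    HasSum (fun j => ‖⟪b j, x⟫_ℂ‖ ^ 2) (‖x‖ ^ 2) := by
  have h := b.hasSum_inner_mul_inner x x
  have e (z : K) : ⟪z, x⟫_ℂ * ⟪x, z⟫_ℂ = ((‖⟪z, x⟫_ℂ‖ ^ 2 : ℝ) : ℂ) := by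
    rw [← inner_conj_symm x z, Complex.mul_conj, Complex.normSq_eq_norm_sq]
  rw [← Complex.hasSum_ofReal]
  have h2 : ((‖x‖ ^ 2 : ℝ) : ℂ) = ⟪x, x⟫_ℂ := by
    rw [inner_self_eq_norm_sq_to_K]
    simp
  rw [h2]
  refine h.congr_fun fun j => ?_
  rw [← e, mul_comm]

/-- Each term is at most the sum of the squares of its two factors, and by Parseval these squares
sum over the basis to `‖ξ n‖²` and `‖η n‖²`. This licenses exchanging the sums over ensemble and
basis. -/
theorem HilbertBasis.summable_prod_inner_mul_inner {J : Type*} (b : HilbertBasis J ℂ K)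
    {ξ η : ι → K}
    (hξ : Summable fun n => ‖ξ n‖ ^ 2) (hη : Summable fun n => ‖η n‖ ^ 2) :
    Summable fun q : ι × J => ⟪ξ q.1, b q.2⟫_ℂ * ⟪b q.2, η q.1⟫_ℂ := by
  have hS : ∀ ζ : ι → K, (Summable fun n => ‖ζ n‖ ^ 2) →
      Summable fun q : ι × J => ‖⟪b q.2, ζ q.1⟫_ℂ‖ ^ 2 := fun ζ hζ => by
    refine (summable_prod_of_nonneg (f := fun q : ι × J => ‖⟪b q.2, ζ q.1⟫_ℂ‖ ^ 2)
      fun q => sq_nonneg _).2 ⟨fun n => (b.hasSum_norm_sq (ζ n)).summable, ?_⟩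
    exact hζ.congr fun n => ((b.hasSum_norm_sq (ζ n)).tsum_eq).symm
  refine Summable.of_norm_bounded ((hS ξ hξ).add (hS η hη)) fun q => ?_
  rw [norm_mul, norm_inner_symm]
  nlinarith [sq_nonneg (‖⟪b q.2, ξ q.1⟫_ℂ‖ - ‖⟪b q.2, η q.1⟫_ℂ‖),
    sq_nonneg (‖⟪b q.2, ξ q.1⟫_ℂ‖ + ‖⟪b q.2, η q.1⟫_ℂ‖)]

theorem summable_rankOne {ξ : ι → K} (h : Summable fun n => ‖ξ n‖ ^ 2) :
    Summable fun n => rankOne ℂ (ξ n) (ξ n) := by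
  refine Summable.of_norm (h.congr fun n => ?_)
  rw [norm_rankOne, sq]

theorem continuousLinearMap_ext_inner {S T : K →L[ℂ] K'} (h : ∀ x y, ⟪x, S y⟫_ℂ = ⟪x, T y⟫_ℂ) :
    S = T := by
  ext y
  exact ext_inner_left ℂ fun x => h x y

namespace IsEnsemble

variable {ρ : K →L[ℂ] K} {ξ : ι → K}

theorem hasSum_inner (h : IsEnsemble ρ ξ) (x y : K) :
    HasSum (fun n => ⟪x, ξ n⟫_ℂ * ⟪ξ n, y⟫_ℂ) ⟪x, ρ y⟫_ℂ := by
  have := ContinuousLinearMap.hasSum_inner h.hasSum x y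
  simpa only [inner_right_rankOne_apply] using this

/-- Square summability already makes the rank-one series converge in norm, so matrix elements
suffice to identify its limit. -/
theorem of_hasSum_inner (h : Summable fun n => ‖ξ n‖ ^ 2)
    (h' : ∀ x y, HasSum (fun n => ⟪x, ξ n⟫_ℂ * ⟪ξ n, y⟫_ℂ) ⟪x, ρ y⟫_ℂ) : IsEnsemble ρ ξ where
  summable := h
  hasSum := by
    have h1 := (summable_rankOne h).hasSum
    convert h1 using 1
    refine continuousLinearMap_ext_inner fun x y => (h' x y).unique ?_
    have := ContinuousLinearMap.hasSum_inner h1 x y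
    simpa only [inner_right_rankOne_apply] using this

theorem map (h : IsEnsemble ρ ξ) (S : K →L[ℂ] K') :
    IsEnsemble (S ∘L ρ ∘L S.adjoint) fun n => S (ξ n) := by
  refine of_hasSum_inner (summable_norm_sq_map h.summable S) fun x y => ?_
  have h1 := h.hasSum_inner (S.adjoint x) (S.adjoint y)
  simp only [ContinuousLinearMap.adjoint_inner_left, ContinuousLinearMap.adjoint_inner_right] at h1
  exact h1

/-- Sum the double family `⟪T* ξₙ, bⱼ⟫ ⟪bⱼ, ξₙ⟫` in two orders: over `j` Parseval gives `⟪ξₙ, T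
ξₙ⟫`, over `n` the ensemble gives `⟪bⱼ, ρ T bⱼ⟫`. The right-hand side does not mention the basis. -/
theorem hasSum_diag {J : Type*} (h : IsEnsemble ρ ξ) (b : HilbertBasis J ℂ K) (T : K →L[ℂ] K) :
    HasSum (fun j => ⟪b j, (ρ ∘L T) (b j)⟫_ℂ) (∑' n, ⟪ξ n, T (ξ n)⟫_ℂ) ∧
      Summable fun n => ⟪ξ n, T (ξ n)⟫_ℂ := by
  have hs := b.summable_prod_inner_mul_inner (summable_norm_sq_map h.summable T.adjoint) h.summable
  have h1 : ∀ n, HasSum (fun j => ⟪T.adjoint (ξ n), b j⟫_ℂ * ⟪b j, ξ n⟫_ℂ) ⟪ξ n, T (ξ n)⟫_ℂ :=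
    fun n => by
      have := b.hasSum_inner_mul_inner (T.adjoint (ξ n)) (ξ n)
      rwa [ContinuousLinearMap.adjoint_inner_left] at this
  have h2 : ∀ j, HasSum (fun n => ⟪T.adjoint (ξ n), b j⟫_ℂ * ⟪b j, ξ n⟫_ℂ)
      ⟪b j, (ρ ∘L T) (b j)⟫_ℂ := fun j => by
    refine (h.hasSum_inner (b j) (T (b j))).congr_fun fun n => ?_
    rw [ContinuousLinearMap.adjoint_inner_left, mul_comm]
  have h3 : HasSum (fun n => ⟪ξ n, T (ξ n)⟫_ℂ) _ := hs.hasSum.prod_fiberwise h1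
  refine ⟨?_, h3.summable⟩
  rw [h3.tsum_eq]
  have h4 := (Equiv.prodComm J ι).hasSum_iff.2 hs.hasSum
  exact h4.prod_fiberwise h2

theorem hasSum_opTrace (h : IsEnsemble ρ ξ) (T : K →L[ℂ] K) :
    HasSum (fun n => ⟪ξ n, T (ξ n)⟫_ℂ) (opTrace (ρ ∘L T)) := by
  obtain ⟨h1, h2⟩ := h.hasSum_diag (onb K) T
  rw [opTrace, h1.tsum_eq]
  exact h2.hasSum

theorem isPositive (h : IsEnsemble ρ ξ) : ρ.IsPositive :=
  isPositive_of_hasSum h.hasSum fun _ => isPositive_rankOne_self _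

/-- Take `T = 1` in the trace formula; positivity is automatic for an ensemble. -/
theorem isState_iff (h : IsEnsemble ρ ξ) : IsState ρ ↔ HasSum (fun n => ‖ξ n‖ ^ 2) 1 := by
  obtain ⟨h2, h3⟩ := h.hasSum_diag (onb K) (ContinuousLinearMap.id ℂ K)
  simp only [ContinuousLinearMap.id_apply, inner_self_eq_norm_sq_to_K,
    ContinuousLinearMap.comp_id] at h2 h3
  rw [IsState, ← Complex.hasSum_ofReal]
  simp only [Complex.ofReal_pow, Complex.ofReal_one]
  constructor
  · rintro ⟨_, h4⟩
    rw [← h2.unique h4]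
    exact h3.hasSum
  · intro h4
    refine ⟨h.isPositive, ?_⟩
    rw [← h4.tsum_eq]
    exact h2

end IsEnsemble

/-- The vectors are `√ρ eⱼ` for the chosen orthonormal basis: their square norms are the diagonal
entries of `ρ`, and `∑ⱼ |√ρ eⱼ⟩⟨√ρ eⱼ| = √ρ √ρ`. -/
theorem IsState.exists_isEnsemble {ρ : K →L[ℂ] K} (h : IsState ρ) :
    ∃ (ι : Type u) (ξ : ι → K), IsEnsemble ρ ξ := by
  obtain ⟨σ, hσ, hρ⟩ : ∃ σ : K →L[ℂ] K, σ.adjoint = σ ∧ σ ∘L σ = ρ := by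
    have h0 := (ContinuousLinearMap.nonneg_iff_isPositive ρ).2 h.1
    refine ⟨CFC.sqrt ρ, ?_, CFC.sqrt_mul_sqrt_self ρ h0⟩
    exact ((ContinuousLinearMap.nonneg_iff_isPositive _).1
      (CFC.sqrt_nonneg ρ)).isSelfAdjoint.adjoint_eq
  have hs (x y : K) : ⟪x, σ y⟫_ℂ = ⟪σ x, y⟫_ℂ := by
    rw [← ContinuousLinearMap.adjoint_inner_left, hσ]
  have hn (x : K) : ⟪x, ρ x⟫_ℂ = ((‖σ x‖ ^ 2 : ℝ) : ℂ) := by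
    rw [← hρ, ContinuousLinearMap.comp_apply, hs, inner_self_eq_norm_sq_to_K]
    simp
  refine ⟨onbIndex K, fun j => σ (onb K j), IsEnsemble.of_hasSum_inner ?_ fun x y => ?_⟩
  · have := h.2.summable
    simp only [hn] at this
    exact Complex.summable_ofReal.1 this
  · have := (onb K).hasSum_inner_mul_inner (σ x) (σ y)
    rw [← hρ, ContinuousLinearMap.comp_apply, hs]
    refine this.congr_fun fun n => ?_
    rw [hs, hs]

/-- Comparison of two traces through ensembles, one of which is indexed by a product. -/
theorem opTrace_eq_of_inner_eq {α β : Type*} {ρ : K →L[ℂ] K} {ρ' : K' →L[ℂ] K'} {ζ : α × β → K}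
    {ξ : α → K'} (hζ : IsEnsemble ρ ζ) (hξ : IsEnsemble ρ' ξ) {T : K →L[ℂ] K}
    {C : β → K' →L[ℂ] K'} {B : K' →L[ℂ] K'} (hB : HasSum C B)
    (h : ∀ q, ⟪ζ q, T (ζ q)⟫_ℂ = ⟪ξ q.1, C q.2 (ξ q.1)⟫_ℂ) :
    opTrace (ρ ∘L T) = opTrace (ρ' ∘L B) := by
  have h1 : HasSum (fun q : α × β => ⟪ξ q.1, C q.2 (ξ q.1)⟫_ℂ) (opTrace (ρ ∘L T)) :=
    (hζ.hasSum_opTrace T).congr_fun fun q => (h q).symm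
  have h2 (n : α) : HasSum (fun m => ⟪ξ n, C m (ξ n)⟫_ℂ) ⟪ξ n, B (ξ n)⟫_ℂ :=
    ContinuousLinearMap.hasSum_inner hB (ξ n) (ξ n)
  have h3 : HasSum (fun n => ⟪ξ n, B (ξ n)⟫_ℂ) (opTrace (ρ ∘L T)) := h1.prod_fiberwise h2
  exact h3.unique (hξ.hasSum_opTrace B)

theorem IsEnsemble.comp_equiv {κ : Type*} {ρ : K →L[ℂ] K} {ξ : ι → K} (h : IsEnsemble ρ ξ)
    (e : κ ≃ ι) : IsEnsemble ρ fun n => ξ (e n) where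
  summable := (e.summable_iff (f := fun n => ‖ξ n‖ ^ 2)).2 h.summable
  hasSum := (e.hasSum_iff (f := fun n => rankOne ℂ (ξ n) (ξ n))).2 h.hasSum

end Ensemble

/-! ### More on tensor products of Hilbert spaces -/

namespace HilbertTensor

open InnerProductSpace

/-! ### Tensor products of operators, series and ensembles -/

section General

variable {ι : Type} [Fintype ι] {H : ι → Type u} [∀ i, NormedAddCommGroup (H i)]
  [∀ i, InnerProductSpace ℂ (H i)]
variable {G : ι → Type u} [∀ i, NormedAddCommGroup (G i)] [∀ i, InnerProductSpace ℂ (G i)]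
variable {E : Type u} [NormedAddCommGroup E] [InnerProductSpace ℂ E] [CompleteSpace E]

theorem norm_tprod (x : ∀ i, H i) : ‖tprod H x‖ = ∏ i, ‖x i‖ := by
  have h : ‖tprod H x‖ ^ 2 = (∏ i, ‖x i‖) ^ 2 := by
    have h1 := inner_tprod x x
    simp only [inner_self_eq_norm_sq_to_K] at h1
    rw [Finset.prod_pow] at h1
    exact_mod_cast h1
  exact (sq_eq_sq₀ (norm_nonneg _) (by positivity)).1 h

variable (H) in
/-- The simple tensor as a continuous multilinear map. -/
def tprodL : ContinuousMultilinearMap ℂ H (HilbertTensor H) :=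
  (tprod H).mkContinuous 1 fun x => by rw [norm_tprod, one_mul]

/-- The simple tensor as a bounded operator in one of its factors. -/
def slot [DecidableEq ι] (x : ∀ i, H i) (i : ι) : H i →L[ℂ] HilbertTensor H :=
  (tprodL H).toContinuousLinearMap x i

theorem slot_apply [DecidableEq ι] (x : ∀ i, H i) (i : ι) (z : H i) :
    slot x i z = tprod H (Function.update x i z) := rfl

/-- Bounded operators with the same matrix elements between simple tensors are equal. -/
theorem ext_inner {S T : HilbertTensor H →L[ℂ] HilbertTensor G}
    (h : ∀ x y, ⟪tprod G x, S (tprod H y)⟫_ℂ = ⟪tprod G x, T (tprod H y)⟫_ℂ) : S = T := by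
  refine HilbertTensor.ext fun y => ?_
  have h1 : innerSL ℂ (S (tprod H y)) = innerSL ℂ (T (tprod H y)) := by
    refine HilbertTensor.ext fun x => ?_
    simp only [innerSL_apply_apply]
    rw [← inner_conj_symm, h x y, inner_conj_symm]
  refine ext_inner_right ℂ fun z => ?_
  exact congrArg (fun f : HilbertTensor G →L[ℂ] ℂ => f z) h1

theorem map_comp {F : ι → Type u} [∀ i, NormedAddCommGroup (F i)]
    [∀ i, InnerProductSpace ℂ (F i)] (S : ∀ i, G i →L[ℂ] F i) (T : ∀ i, H i →L[ℂ] G i) :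
    map S ∘L map T = map fun i => S i ∘L T i :=
  HilbertTensor.ext fun x => by simp [map_tprod]

theorem map_one : map (fun i => (1 : H i →L[ℂ] H i)) = 1 :=
  HilbertTensor.ext fun x => by simp [map_tprod]

theorem inner_map_tprod (T : ∀ i, H i →L[ℂ] G i) (x : ∀ i, G i) (y : ∀ i, H i) :
    ⟪tprod G x, map T (tprod H y)⟫_ℂ = ∏ i, ⟪x i, T i (y i)⟫_ℂ := by
  rw [map_tprod, inner_tprod]

theorem map_smul (T : ∀ i, H i →L[ℂ] G i) (c : ι → ℂ) :
    map (fun i => c i • T i) = (∏ i, c i) • map T := by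
  refine ext_inner fun x y => ?_
  rw [inner_map_tprod, smul_apply, inner_smul_right, inner_map_tprod,
    ← Finset.prod_mul_distrib]
  simp

theorem norm_map_le (T : ∀ i, H i →L[ℂ] G i) : ‖map T‖ ≤ ∏ i, ‖T i‖ := by
  have h : ∀ z : HilbertTensor H, ‖map T z‖ ≤ (∏ i, ‖T i‖) * ‖z‖ := fun z => by
    induction z using UniformSpace.Completion.induction_on with
    | hp => exact isClosed_le (by fun_prop) (by fun_prop)
    | ih z =>
      rw [map, ContinuousLinearMap.completion_apply_coe, UniformSpace.Completion.norm_coe,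
        UniformSpace.Completion.norm_coe]
      exact AlgTensor.norm_map_le T z
  exact ContinuousLinearMap.opNorm_le_bound _ (by positivity) h

theorem adjoint_map [∀ i, CompleteSpace (H i)] [∀ i, CompleteSpace (G i)]
    (T : ∀ i, H i →L[ℂ] G i) : (map T).adjoint = map fun i => (T i).adjoint := by
  refine ext_inner fun x y => ?_
  rw [ContinuousLinearMap.adjoint_inner_right, map_tprod, inner_tprod, inner_map_tprod]
  simp [ContinuousLinearMap.adjoint_inner_right]

/-- With `Sᵢ = √Tᵢ`, the tensor product of the `Tᵢ` is `(⨂ Sᵢ)* (⨂ Sᵢ)`. -/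
theorem isPositive_map [∀ i, CompleteSpace (H i)] (T : ∀ i, H i →L[ℂ] H i)
    (hT : ∀ i, (T i).IsPositive) : (map T).IsPositive := by
  have h (i : ι) : ∃ S : H i →L[ℂ] H i, S.adjoint ∘L S = T i := by
    have h0 := (ContinuousLinearMap.nonneg_iff_isPositive (T i)).2 (hT i)
    refine ⟨CFC.sqrt (T i), ?_⟩
    rw [((ContinuousLinearMap.nonneg_iff_isPositive _).1
      (CFC.sqrt_nonneg (T i))).isSelfAdjoint.adjoint_eq]
    exact CFC.sqrt_mul_sqrt_self (T i) h0
  choose S hS using h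
  have h1 : map T = (map S).adjoint ∘L map S := by
    rw [adjoint_map, map_comp]
    simp only [hS]
  rw [h1]
  exact ContinuousLinearMap.isPositive_adjoint_comp_self _

theorem inner_map_map [∀ i, CompleteSpace (H i)] [∀ i, CompleteSpace (G i)]
    (P : ∀ i, H i →L[ℂ] G i) (T : ∀ i, G i →L[ℂ] G i) (z : HilbertTensor H) :
    ⟪map P z, map T (map P z)⟫_ℂ = ⟪z, map (fun i => (P i).adjoint ∘L T i ∘L P i) z⟫_ℂ := by
  rw [← map_comp, ← map_comp, ← adjoint_map, ContinuousLinearMap.comp_apply,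
    ContinuousLinearMap.comp_apply, ContinuousLinearMap.adjoint_inner_right]

/-- The norm of a tensor product is at most the product of the norms, so the product series
converges absolutely. Its sum is then identified by matrix elements between simple tensors, where it
is a product of scalar series. -/
theorem hasSum_map {α : ι → Type u} {C : ∀ i, α i → H i →L[ℂ] H i} {B : ∀ i, H i →L[ℂ] H i}
    (hB : ∀ i, HasSum (C i) (B i)) (hC : ∀ i, Summable fun n => ‖C i n‖) :
    HasSum (fun n : ∀ i, α i => map fun i => C i (n i)) (map B) := by
  have hs : Summable fun n : ∀ i, α i => map fun i => C i (n i) := by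
    have h1 := (hasSum_pi_prod (fun i n => ((‖C i n‖ : ℝ) : ℂ)) _
      (fun i => (Complex.hasSum_ofReal.2 (hC i).hasSum)) fun i => by simpa using hC i).2
    refine Summable.of_norm_bounded h1 fun n => ?_
    rw [← Complex.ofReal_prod, Complex.norm_real]
    exact (norm_map_le _).trans (le_abs_self _)
  convert hs.hasSum using 1
  refine ext_inner fun x y => ?_
  have h2 := ContinuousLinearMap.hasSum_inner hs.hasSum (tprod H x) (tprod H y)
  refine HasSum.unique ?_ h2
  simp only [inner_map_tprod]
  refine (hasSum_pi_prod (fun i n => ⟪x i, C i n (y i)⟫_ℂ) _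
    (fun i => ?_) fun i => ?_).1
  · exact ((hB i).mapL (ContinuousLinearMap.apply ℂ (H i) (y i))).mapL (innerSL ℂ (x i))
  · refine Summable.of_nonneg_of_le (fun _ => norm_nonneg _) (fun n => ?_)
      (((hC i).mul_right ‖y i‖).mul_left ‖x i‖)
    refine (norm_inner_le_norm _ _).trans ?_
    gcongr
    exact (C i n).le_opNorm _

theorem map_rankOne (x : ∀ i, G i) (y : ∀ i, H i) :
    map (fun i => rankOne ℂ (x i) (y i)) = rankOne ℂ (tprod G x) (tprod H y) := by
  refine HilbertTensor.ext fun z => ?_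
  simp only [map_tprod, rankOne_apply, inner_tprod]
  exact (tprod G).map_smul_univ _ _

theorem isEnsemble_map [∀ i, CompleteSpace (H i)] {α : ι → Type u} {ρ : ∀ i, H i →L[ℂ] H i}
    {ξ : ∀ i, α i → H i} (h : ∀ i, IsEnsemble (ρ i) (ξ i)) :
    IsEnsemble (map ρ) fun n : ∀ i, α i => tprod H fun i => ξ i (n i) where
  summable := by
    have h1 := (hasSum_pi_prod (fun i n => ((‖ξ i n‖ ^ 2 : ℝ) : ℂ)) _
      (fun i => (Complex.hasSum_ofReal.2 (h i).summable.hasSum))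
      fun i => by simpa using (h i).summable).2
    refine h1.congr fun n => ?_
    rw [← Complex.ofReal_prod, Complex.norm_real, norm_tprod, Finset.prod_pow, norm_pow,
      Real.norm_eq_abs, sq_abs]
  hasSum := by
    have h1 := hasSum_map (fun i => (h i).hasSum) fun i => by
      simpa only [norm_rankOne, ← sq] using (h i).summable
    simpa only [map_rankOne] using h1

/-- A multilinear map which preserves the inner products of simple tensors up to a constant factor
extends to the Hilbert space tensor product. -/
theorem exists_lift (Φ : MultilinearMap ℂ H E) (c : ℝ) (hc : 0 ≤ c)
    (hΦ : ∀ x y, ⟪Φ x, Φ y⟫_ℂ = c ^ 2 * ∏ i, ⟪x i, y i⟫_ℂ) :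
    ∃ L : HilbertTensor H →L[ℂ] E, (∀ x, L (tprod H x) = Φ x) ∧ ‖L‖ ≤ c := by
  let A : AlgTensor H →ₗ[ℂ] E := PiTensorProduct.lift Φ
  have hA (x : ∀ i, H i) : A (AlgTensor.tprod H x) = Φ x := PiTensorProduct.lift.tprod x
  have hin (x y : AlgTensor H) : ⟪A x, A y⟫_ℂ = c ^ 2 * ⟪x, y⟫_ℂ := by
    induction x using AlgTensor.induction with
    | smul r x =>
      induction y using AlgTensor.induction with
      | smul s y =>
        simp only [_root_.map_smul, inner_smul_left, inner_smul_right, hA, hΦ]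
        rw [AlgTensor.inner_tprod]
        ring
      | add a b ha hb => simp only [map_add, inner_add_right, ha, hb, mul_add]
    | add a b ha hb => simp only [map_add, inner_add_left, ha, hb, mul_add]
  have hb (z : AlgTensor H) : ‖A z‖ ≤ c * ‖z‖ := by
    have h : ‖A z‖ ^ 2 = (c * ‖z‖) ^ 2 := by
      have h1 := hin z z
      simp only [inner_self_eq_norm_sq_to_K] at h1
      rw [mul_pow]
      refine Complex.ofReal_injective ?_
      push_cast
      exact h1
    exact ((sq_eq_sq₀ (norm_nonneg _) (by positivity)).1 h).le
  refine ⟨(A.mkContinuous c hb).fromCompletion, fun x => ?_,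
    ContinuousLinearMap.opNorm_le_bound _ hc fun z => ?_⟩
  · rw [tprod_eq_coe, ContinuousLinearMap.fromCompletion_apply_coe]
    exact hA x
  · induction z using UniformSpace.Completion.induction_on with
    | hp => exact isClosed_le (by fun_prop) (by fun_prop)
    | ih z =>
      rw [ContinuousLinearMap.fromCompletion_apply_coe, UniformSpace.Completion.norm_coe]
      exact hb z

end General

section Slots

variable {κ : Type} [Fintype κ] [DecidableEq κ] {ι : κ → Type} [∀ k, Fintype (ι k)]
  {H : ∀ k, ι k → Type u} [∀ k i, NormedAddCommGroup (H k i)]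
  [∀ k i, InnerProductSpace ℂ (H k i)]
  {E : Type u} [NormedAddCommGroup E] [NormedSpace ℂ E]

/-- Maps of several tensors which are linear and continuous in each argument are equal if they agree
on simple tensors. -/
theorem ext_slots {f g : (∀ k, HilbertTensor (H k)) → E}
    (hf : ∀ ξ k, ∃ L : HilbertTensor (H k) →L[ℂ] E, ∀ z, f (Function.update ξ k z) = L z)
    (hg : ∀ ξ k, ∃ L : HilbertTensor (H k) →L[ℂ] E, ∀ z, g (Function.update ξ k z) = L z)
    (h : ∀ x : ∀ k i, H k i, f (fun k => tprod (H k) (x k)) = g fun k => tprod (H k) (x k))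
    (ξ : ∀ k, HilbertTensor (H k)) : f ξ = g ξ := by
  -- Induction on the set `s` of slots that may hold arbitrary vectors. Enlarging `s` by `k`
  -- compares two bounded operators in slot `k`, which agree on simple tensors by the inductive
  -- hypothesis.
  have key : ∀ (s : Finset κ) (ξ : ∀ k, HilbertTensor (H k)),
      (∀ k ∉ s, ∃ x, ξ k = tprod (H k) x) → f ξ = g ξ := fun s => by
    induction s using Finset.induction_on with
    | empty =>
      intro ξ hξ
      choose x hx using fun k => hξ k (Finset.notMem_empty k)
      rw [show ξ = fun k => tprod (H k) (x k) from funext hx]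
      exact h x
    | insert k s hk ih =>
      intro ξ hξ
      obtain ⟨L, hL⟩ := hf ξ k
      obtain ⟨M, hM⟩ := hg ξ k
      have hLM : L = M := by
        refine HilbertTensor.ext fun x => ?_
        rw [← hL, ← hM]
        refine ih _ fun j hj => ?_
        by_cases hjk : j = k
        · subst hjk
          exact ⟨x, by simp⟩
        · obtain ⟨y, hy⟩ := hξ j (by simp [hj, hjk])
          exact ⟨y, by simp [hjk, hy]⟩
      have h1 := hL (ξ k)
      have h2 := hM (ξ k)
      rw [Function.update_eq_self] at h1 h2
      rw [h1, h2, hLM]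
  exact key Finset.univ ξ fun k hk => absurd (Finset.mem_univ k) hk

end Slots

/-! ### Regrouping of factors as an isometry -/

section Group

variable {ι κ : Type} [Fintype ι] [Fintype κ] [DecidableEq κ] {H : ι → Type u}
  [∀ i, NormedAddCommGroup (H i)] [∀ i, InnerProductSpace ℂ (H i)] (f : ι → κ)

/-- Inner products of simple tensors multiply fibre by fibre. Only this half of unitarity is used
for `group`. -/
theorem adjoint_group_comp_group : (group (H := H) f).adjoint ∘L group f = 1 := by
  refine ext_inner fun x y => ?_
  rw [ContinuousLinearMap.comp_apply, ContinuousLinearMap.adjoint_inner_right, group_tprod,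
    group_tprod, one_apply_eq_self, inner_tprod, inner_tprod]
  simp only [inner_tprod]
  exact Fintype.prod_fiberwise f fun i => ⟪x i, y i⟫_ℂ

theorem adjoint_group_group (z : HilbertTensor H) : (group f).adjoint (group f z) = z :=
  congrArg (fun T : HilbertTensor H →L[ℂ] HilbertTensor H => T z) (adjoint_group_comp_group f)

theorem group_comp_map (T : ∀ i, H i →L[ℂ] H i) :
    group f ∘L map T = map (fun k => map fun i : {i // f i = k} => T i.1) ∘L group f := by
  refine HilbertTensor.ext fun x => ?_
  rw [ContinuousLinearMap.comp_apply, ContinuousLinearMap.comp_apply, map_tprod, group_tprod,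
    group_tprod, map_tprod]
  refine congrArg (tprod (Block H f)) (funext fun i => ?_)
  rw [map_tprod]

theorem inner_map_eq_inner_group (T : ∀ i, H i →L[ℂ] H i) (z : HilbertTensor H) :
    ⟪z, map T z⟫_ℂ =
      ⟪group f z, map (fun k => map fun i : {i // f i = k} => T i.1) (group f z)⟫_ℂ := by
  have h := congrArg (fun S : HilbertTensor H →L[ℂ] HilbertTensor (Block H f) => S z)
    (group_comp_map f T)
  simp only [ContinuousLinearMap.comp_apply] at h
  rw [← h, ← ContinuousLinearMap.adjoint_inner_right, adjoint_group_group]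

theorem inner_groupMap_eq (T : ∀ k, Block H f k →L[ℂ] Block H f k) (z : HilbertTensor H) :
    ⟪z, groupMap f T z⟫_ℂ = ⟪group f z, map T (group f z)⟫_ℂ := by
  rw [groupMap, ContinuousLinearMap.comp_apply, ContinuousLinearMap.adjoint_inner_right,
    ContinuousLinearMap.comp_apply]

/-- The reordered operator is the tensor product conjugated by the adjoint of `group f`, so the
product ensemble is pushed forward along that adjoint. -/
theorem isEnsemble_groupMap {α : κ → Type u} {ρ : ∀ k, Block H f k →L[ℂ] Block H f k}
    {ξ : ∀ k, α k → Block H f k} (h : ∀ k, IsEnsemble (ρ k) (ξ k)) :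
    IsEnsemble (groupMap f ρ) fun n : ∀ k, α k =>
      (group f).adjoint (tprod (Block H f) fun k => ξ k (n k)) := by
  have h1 := (isEnsemble_map h).map (group f).adjoint
  rw [ContinuousLinearMap.adjoint_adjoint] at h1
  exact h1

end Group

/-! ### Tensor products over two indices -/

section Pair

variable {ι : Type} [Fintype ι] [DecidableEq ι] {H : ι → Type u} [∀ i, NormedAddCommGroup (H i)]
  [∀ i, InnerProductSpace ℂ (H i)]

/-- The index set consists of the two distinct elements `i` and `j`. -/
structure IsPair (i j : ι) : Prop where
  ne : i ≠ j
  eq_or_eq : ∀ k, k = i ∨ k = j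

theorem IsPair.prod_eq {i j : ι} (h : IsPair i j) (g : ι → ℂ) : ∏ k, g k = g i * g j := by
  have hu : (Finset.univ : Finset ι) = {i, j} := by
    ext k
    simpa using h.eq_or_eq k
  rw [hu, Finset.prod_pair h.ne]

/-- The tensor of two vectors, for an index set with two elements. -/
def pair (i j : ι) (a : H i) (b : H j) : HilbertTensor H :=
  tprod H (Function.update (Function.update 0 i a) j b)

variable {i j : ι}

theorem tprod_eq_pair (h : IsPair i j) (x : ∀ k, H k) : tprod H x = pair i j (x i) (x j) := by
  rw [pair]
  congr 1
  funext k
  rcases h.eq_or_eq k with rfl | rfl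
  · rw [Function.update_of_ne h.ne, Function.update_self]
  · rw [Function.update_self]

theorem pair_eq_comm (h : IsPair i j) (a : H i) (b : H j) :
    pair i j a b = tprod H (Function.update (Function.update 0 j b) i a) := by
  rw [pair, Function.update_comm h.ne]

theorem inner_pair (h : IsPair i j) (a a' : H i) (b b' : H j) :
    ⟪pair i j a b, pair i j a' b'⟫_ℂ = ⟪a, a'⟫_ℂ * ⟪b, b'⟫_ℂ := by
  rw [pair, pair, inner_tprod, h.prod_eq]
  simp [Function.update_of_ne h.ne]

theorem map_pair (h : IsPair i j) {G : ι → Type u}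
    [∀ i, NormedAddCommGroup (G i)] [∀ i, InnerProductSpace ℂ (G i)]
    (T : ∀ i, H i →L[ℂ] G i) (a : H i) (b : H j) :
    map T (pair i j a b) = pair i j (T i a) (T j b) := by
  rw [pair, map_tprod, tprod_eq_pair h]
  simp [Function.update_of_ne h.ne]

/-- The tensor of two vectors as a bilinear map. -/
def pairₗ (h : IsPair i j) : H i →ₗ[ℂ] H j →ₗ[ℂ] HilbertTensor H :=
  LinearMap.mk₂ ℂ (pair i j)
    (fun a a' b => by simp only [pair_eq_comm h, MultilinearMap.map_update_add])
    (fun c a b => by simp only [pair_eq_comm h, MultilinearMap.map_update_smul])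
    (fun a b b' => by simp only [pair, MultilinearMap.map_update_add])
    (fun c a b => by simp only [pair, MultilinearMap.map_update_smul])

theorem pairₗ_apply (h : IsPair i j) (a : H i) (b : H j) : pairₗ h a b = pair i j a b := rfl

/-- A bilinear map as a multilinear map, for an index set with two elements. -/
def multilinearOfPair (h : IsPair i j) {E : Type u} [AddCommGroup E] [Module ℂ E]
    (B : H i →ₗ[ℂ] H j →ₗ[ℂ] E) :
    MultilinearMap ℂ H E where
  toFun x := B (x i) (x j)
  map_update_add' := by
    intro hdec x k a b
    have hne := h.ne
    rcases h.eq_or_eq k with rfl | rfl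
    · simp [Function.update_of_ne hne.symm]
    · simp [Function.update_of_ne hne]
  map_update_smul' := by
    intro hdec x k c a
    have hne := h.ne
    rcases h.eq_or_eq k with rfl | rfl
    · simp [Function.update_of_ne hne.symm]
    · simp [Function.update_of_ne hne]

/-- The tensor product of two operators, for an index set with two elements. -/
def pairMap (i j : ι) (S : H i →L[ℂ] H i) (R : H j →L[ℂ] H j) :
    HilbertTensor H →L[ℂ] HilbertTensor H :=
  map (Function.update (Function.update (fun _ => 1) i S) j R)

theorem inner_pairMap_tprod (h : IsPair i j) (S : H i →L[ℂ] H i) (R : H j →L[ℂ] H j)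
    (x y : ∀ k, H k) :
    ⟪tprod H x, pairMap i j S R (tprod H y)⟫_ℂ = ⟪x i, S (y i)⟫_ℂ * ⟪x j, R (y j)⟫_ℂ := by
  rw [pairMap, inner_map_tprod, h.prod_eq, Function.update_self, Function.update_of_ne h.ne,
    Function.update_self]

theorem inner_pairMap_pair (h : IsPair i j) (S : H i →L[ℂ] H i) (R : H j →L[ℂ] H j)
    (a a' : H i) (b b' : H j) :
    ⟪pair i j a b, pairMap i j S R (pair i j a' b')⟫_ℂ = ⟪a, S a'⟫_ℂ * ⟪b, R b'⟫_ℂ := by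
  rw [pair, pair, inner_pairMap_tprod h]
  simp [Function.update_of_ne h.ne]

theorem isPositive_pairMap [∀ k, CompleteSpace (H k)] (h : IsPair i j) {S : H i →L[ℂ] H i}
    {R : H j →L[ℂ] H j} (hS : S.IsPositive) (hR : R.IsPositive) :
    (pairMap i j S R).IsPositive := by
  refine isPositive_map _ fun k => ?_
  rcases h.eq_or_eq k with rfl | rfl
  · rw [Function.update_of_ne h.ne, Function.update_self]
    exact hS
  · rw [Function.update_self]
    exact hR

end Pair

/-! ### Tensor products over one index -/

section Single

variable {ι : Type} [Fintype ι] [DecidableEq ι] {H : ι → Type u} [∀ i, NormedAddCommGroup (H i)]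
  [∀ i, InnerProductSpace ℂ (H i)]

/-- A vector regarded as a simple tensor, for an index set with one element. -/
def single (i : ι) : H i →ₗ[ℂ] HilbertTensor H := (tprod H).toLinearMap 0 i

variable {i : ι}

theorem prod_eq_of_forall_eq (h : ∀ k, k = i) (g : ι → ℂ) : ∏ k, g k = g i := by
  have hu : (Finset.univ : Finset ι) = {i} := by
    ext k
    simpa using h k
  rw [hu, Finset.prod_singleton]

theorem tprod_eq_single (h : ∀ k, k = i) (x : ∀ k, H k) : tprod H x = single i (x i) := by
  rw [single, MultilinearMap.toLinearMap_apply]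
  congr 1
  funext k
  obtain rfl := h k
  simp

theorem inner_single (h : ∀ k, k = i) (a b : H i) :
    ⟪single i a, single (H := H) i b⟫_ℂ = ⟪a, b⟫_ℂ := by
  rw [single, MultilinearMap.toLinearMap_apply, MultilinearMap.toLinearMap_apply, inner_tprod,
    prod_eq_of_forall_eq h]
  simp

/-- An operator on the only factor, for an index set with one element. -/
def singleMap (i : ι) (S : H i →L[ℂ] H i) : HilbertTensor H →L[ℂ] HilbertTensor H :=
  map (Function.update (fun _ => 1) i S)

theorem inner_singleMap_tprod (h : ∀ k, k = i) (S : H i →L[ℂ] H i) (x y : ∀ k, H k) :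
    ⟪tprod H x, singleMap i S (tprod H y)⟫_ℂ = ⟪x i, S (y i)⟫_ℂ := by
  rw [singleMap, inner_map_tprod, prod_eq_of_forall_eq h, Function.update_self]

theorem inner_singleMap_single (h : ∀ k, k = i) (S : H i →L[ℂ] H i) (a b : H i) :
    ⟪single i a, singleMap i S (single i b)⟫_ℂ = ⟪a, S b⟫_ℂ := by
  rw [single, MultilinearMap.toLinearMap_apply, MultilinearMap.toLinearMap_apply,
    inner_singleMap_tprod h, Function.update_self, Function.update_self]

theorem isPositive_singleMap [∀ k, CompleteSpace (H k)] (h : ∀ k, k = i) {S : H i →L[ℂ] H i}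
    (hS : S.IsPositive) : (singleMap i S).IsPositive := by
  refine isPositive_map _ fun k => ?_
  obtain rfl := h k
  rw [Function.update_self]
  exact hS

end Single

end HilbertTensor

/-! ### Systems connected in the shape of a multiarm scenario -/

/-- Connections `c` between sources `src c` and measurements `meas c` of the shape of the multiarm
scenario: for every `i` there is one connection each between `none` and `inl i`, between `some i`
and `inl i`, and between `some i` and `inr i`, and there are no other connections. -/
structure ArmSystem {ι : Type} {k : ℕ} (src : ι → Option (Fin k)) (meas : ι → Fin k ⊕ Fin k) where
  conn₀ : Fin k → ι
  conn₁ : Fin k → ι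
  conn₂ : Fin k → ι
  src_conn₀ : ∀ i, src (conn₀ i) = none
  src_conn₁ : ∀ i, src (conn₁ i) = some i
  src_conn₂ : ∀ i, src (conn₂ i) = some i
  meas_conn₀ : ∀ i, meas (conn₀ i) = .inl i
  meas_conn₁ : ∀ i, meas (conn₁ i) = .inl i
  meas_conn₂ : ∀ i, meas (conn₂ i) = .inr i
  exists_eq : ∀ c, ∃ i, c = conn₀ i ∨ c = conn₁ i ∨ c = conn₂ i

namespace ArmSystem

open HilbertTensor InnerProductSpace

attribute [local irreducible] AlgTensor.form PiTensorProduct.lift HilbertTensor.tprod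
  HilbertTensor.map
  HilbertTensor.group

variable {k : ℕ} {ι : Type} [Fintype ι] [DecidableEq ι] {src : ι → Option (Fin k)}
  {meas : ι → Fin k ⊕ Fin k} (D : ArmSystem src meas)

/-- The arm to which a measurement belongs. -/
def arm : Fin k ⊕ Fin k → Fin k := Sum.elim id id

theorem arm_inl (i : Fin k) : arm (.inl i) = i := rfl

theorem arm_inr (i : Fin k) : arm (.inr i) = i := rfl

theorem isPair_inl (i : Fin k) :
    IsPair (ι := {c : ι // meas c = .inl i}) ⟨D.conn₀ i, D.meas_conn₀ i⟩
      ⟨D.conn₁ i, D.meas_conn₁ i⟩ where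
  ne h := by
    have h1 := D.src_conn₀ i
    rw [show D.conn₀ i = D.conn₁ i from Subtype.ext_iff.1 h, D.src_conn₁] at h1
    cases h1
  eq_or_eq := by
    rintro ⟨c, hc⟩
    obtain ⟨j, rfl | rfl | rfl⟩ := D.exists_eq c
    · obtain rfl : j = i := by simpa [D.meas_conn₀] using hc
      exact .inl rfl
    · obtain rfl : j = i := by simpa [D.meas_conn₁] using hc
      exact .inr rfl
    · simp [D.meas_conn₂] at hc

theorem isPair_some (i : Fin k) :
    IsPair (ι := {c : ι // src c = some i}) ⟨D.conn₁ i, D.src_conn₁ i⟩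
      ⟨D.conn₂ i, D.src_conn₂ i⟩ where
  ne h := by
    have h1 := D.meas_conn₁ i
    rw [show D.conn₁ i = D.conn₂ i from Subtype.ext_iff.1 h, D.meas_conn₂] at h1
    cases h1
  eq_or_eq := by
    rintro ⟨c, hc⟩
    obtain ⟨j, rfl | rfl | rfl⟩ := D.exists_eq c
    · simp [D.src_conn₀] at hc
    · obtain rfl : j = i := by simpa [D.src_conn₁] using hc
      exact .inl rfl
    · obtain rfl : j = i := by simpa [D.src_conn₂] using hc
      exact .inr rfl

theorem eq_conn₂ (i : Fin k) (c : {c : ι // meas c = .inr i}) :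
    c = ⟨D.conn₂ i, D.meas_conn₂ i⟩ := by
  obtain ⟨c, hc⟩ := c
  obtain ⟨j, rfl | rfl | rfl⟩ := D.exists_eq c
  · simp [D.meas_conn₀] at hc
  · simp [D.meas_conn₁] at hc
  · obtain rfl : j = i := by simpa [D.meas_conn₂] using hc
    rfl

theorem isPair_arm (i : Fin k) :
    IsPair (ι := {m : Fin k ⊕ Fin k // arm m = i}) ⟨.inl i, arm_inl i⟩ ⟨.inr i, arm_inr i⟩ where
  ne h := nomatch Subtype.ext_iff.1 h
  eq_or_eq := by
    rintro ⟨l | l, h⟩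
    · cases h; exact .inl rfl
    · cases h; exact .inr rfl

theorem exists_eq_conn₀ (c : {c : ι // src c = none}) :
    ∃ i, c = ⟨D.conn₀ i, D.src_conn₀ i⟩ := by
  obtain ⟨c, hc⟩ := c
  obtain ⟨j, rfl | rfl | rfl⟩ := D.exists_eq c
  · exact ⟨j, rfl⟩
  · simp [D.src_conn₁] at hc
  · simp [D.src_conn₂] at hc

theorem conn₀_injective : Function.Injective D.conn₀ := fun i j h => by
  have h1 := D.meas_conn₀ i
  rw [h, D.meas_conn₀] at h1
  exact (Sum.inl_injective h1).symm

/-- The connections of the source `none` correspond to the arms. -/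
def noneEquiv : Fin k ≃ {c : ι // src c = none} :=
  Equiv.ofBijective (fun i => ⟨D.conn₀ i, D.src_conn₀ i⟩)
    ⟨fun _ _ h => D.conn₀_injective (Subtype.ext_iff.1 h),
      fun c => (D.exists_eq_conn₀ c).imp fun _ h => h.symm⟩

variable (H : ι → Type u) [∀ c, NormedAddCommGroup (H c)] [∀ c, InnerProductSpace ℂ (H c)]

variable (src) in
/-- The systems emitted by a source. -/
abbrev SourceSpace (s : Option (Fin k)) : Type u := Block H src s

variable (meas) in
/-- The systems received by a measurement. -/
abbrev MeasSpace (m : Fin k ⊕ Fin k) : Type u := Block H meas m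

variable (meas) in
/-- The systems received by the two measurements of an arm. -/
abbrev ArmSpace (i : Fin k) : Type u := Block (MeasSpace meas H) arm i

/-- The system received by the measurement `inl i` from the source `none`. -/
abbrev Local (i : Fin k) : Type u := H (D.conn₀ i)

variable {H}

/-- Simple tensors of the systems received by the measurements of an arm. -/
def armTensor (i : Fin k) (φ : H (D.conn₀ i)) (a : H (D.conn₁ i)) (b : H (D.conn₂ i)) :
    ArmSpace meas H i :=
  pair (H := fun m : {m : Fin k ⊕ Fin k // arm m = i} => MeasSpace meas H m.1)
    ⟨.inl i, arm_inl i⟩ ⟨.inr i, arm_inr i⟩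
    (pair (H := fun c : {c : ι // meas c = .inl i} => H c.1)
      ⟨D.conn₀ i, D.meas_conn₀ i⟩ ⟨D.conn₁ i, D.meas_conn₁ i⟩ φ a)
    (single (H := fun c : {c : ι // meas c = .inr i} => H c.1)
      ⟨D.conn₂ i, D.meas_conn₂ i⟩ b)

/-- `D.armTensor` as a bilinear map. -/
def armTensorₗ (i : Fin k) (φ : H (D.conn₀ i)) :
    H (D.conn₁ i) →ₗ[ℂ] H (D.conn₂ i) →ₗ[ℂ] ArmSpace meas H i :=
  (pairₗ (H := fun m : {m : Fin k ⊕ Fin k // arm m = i} => MeasSpace meas H m.1)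
    (isPair_arm i)).compl₁₂
    (pairₗ (H := fun c : {c : ι // meas c = .inl i} => H c.1)
      (D.isPair_inl i) φ)
    (single (H := fun c : {c : ι // meas c = .inr i} => H c.1)
      ⟨D.conn₂ i, D.meas_conn₂ i⟩)

/-- With `armTensor_smul`, this is what makes the insertion of a local vector linear in that vector.
-/
theorem armTensor_add (i : Fin k) (φ φ' : H (D.conn₀ i)) (a : H (D.conn₁ i)) (b : H (D.conn₂ i)) :
    D.armTensor i (φ + φ') a b = D.armTensor i φ a b + D.armTensor i φ' a b := by
  have h := LinearMap.map_add₂ (pairₗ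
    (H := fun c : {c : ι // meas c = .inl i} => H c.1) (D.isPair_inl i)) φ φ' a
  rw [pairₗ_apply, pairₗ_apply, pairₗ_apply] at h
  rw [armTensor, h]
  exact LinearMap.map_add₂ (pairₗ
    (H := fun m : {m : Fin k ⊕ Fin k // arm m = i} => MeasSpace meas H m.1) (isPair_arm i)) _ _ _

theorem armTensor_smul (i : Fin k) (c : ℂ) (φ : H (D.conn₀ i)) (a : H (D.conn₁ i))
    (b : H (D.conn₂ i)) :
    D.armTensor i (c • φ) a b = c • D.armTensor i φ a b := by
  have h := LinearMap.map_smul₂ (pairₗ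
    (H := fun c : {c : ι // meas c = .inl i} => H c.1) (D.isPair_inl i)) c φ a
  rw [pairₗ_apply, pairₗ_apply] at h
  rw [armTensor, h]
  exact LinearMap.map_smul₂ (pairₗ
    (H := fun m : {m : Fin k ⊕ Fin k // arm m = i} => MeasSpace meas H m.1) (isPair_arm i)) _ _ _

theorem inner_armTensor (i : Fin k) (φ φ' : H (D.conn₀ i)) (a a' : H (D.conn₁ i))
    (b b' : H (D.conn₂ i)) :
    ⟪D.armTensor i φ a b, D.armTensor i φ' a' b'⟫_ℂ = ⟪φ, φ'⟫_ℂ * ⟪a, a'⟫_ℂ * ⟪b, b'⟫_ℂ := by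
  rw [armTensor, armTensor, inner_pair (isPair_arm i)]
  refine congrArg₂ _ (inner_pair (D.isPair_inl i) _ _ _ _) (inner_single (D.eq_conn₂ i) _ _)

theorem tprod_eq_armTensor (i : Fin k) (x : ∀ c, H c) :
    (tprod (fun m : {m : Fin k ⊕ Fin k // arm m = i} => MeasSpace meas H m.1) fun m =>
      tprod (fun c : {c // meas c = m.1} => H c.1) fun c => x c.1) =
    D.armTensor i (x (D.conn₀ i)) (x (D.conn₁ i)) (x (D.conn₂ i)) := by
  rw [tprod_eq_pair (isPair_arm i), armTensor]
  congr 1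
  · exact tprod_eq_pair (D.isPair_inl i) _
  · exact tprod_eq_single (D.eq_conn₂ i) _

theorem exists_continuousLinearMap_of_bound {A B C : Type u} [NormedAddCommGroup A]
    [NormedSpace ℂ A] [NormedAddCommGroup B] [NormedSpace ℂ B] [NormedAddCommGroup C]
    [NormedSpace ℂ C] (L : A → B →L[ℂ] C) (h_add : ∀ a b, L (a + b) = L a + L b)
    (h_smul : ∀ (c : ℂ) a, L (c • a) = c • L a) (hn : ∀ a, ‖L a‖ ≤ ‖a‖) :
    ∃ V : A →L[ℂ] B →L[ℂ] C, ∀ a, V a = L a :=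
  ⟨LinearMap.mkContinuous { toFun := L, map_add' := h_add, map_smul' := h_smul } 1
    fun a => by simpa using hn a, fun _ => rfl⟩

/-- For fixed `φ` the map `a ⊗ b ↦ (φ ⊗ a) ⊗ b` multiplies inner products by `‖φ‖²`, so it extends
to the whole source space with norm at most `‖φ‖`. Linearity in `φ` is checked on simple tensors,
and the norm bound gives continuity. -/
theorem exists_armInsert (i : Fin k) :
    ∃ V : H (D.conn₀ i) →L[ℂ] SourceSpace src H (some i) →L[ℂ] ArmSpace meas H i,
      ∀ φ (x : ∀ c : {c : ι // src c = some i}, H c.1),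
        V φ (tprod _ x) =
          D.armTensor i φ (x ⟨D.conn₁ i, D.src_conn₁ i⟩) (x ⟨D.conn₂ i, D.src_conn₂ i⟩) := by
  have h (φ : H (D.conn₀ i)) := exists_lift
    (H := fun c : {c : ι // src c = some i} => H c.1)
    (multilinearOfPair (D.isPair_some i) (D.armTensorₗ i φ)) ‖φ‖ (norm_nonneg _) fun x y => by
      refine (D.inner_armTensor i _ _ _ _ _ _).trans ?_
      rw [(D.isPair_some i).prod_eq, inner_self_eq_norm_sq_to_K, mul_assoc]
      rfl
  choose L hL hn using h
  have hL' (φ : H (D.conn₀ i)) (x : ∀ c : {c : ι // src c = some i}, H c.1) :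
    L φ (tprod _ x) =
      D.armTensor i φ (x ⟨D.conn₁ i, D.src_conn₁ i⟩) (x ⟨D.conn₂ i, D.src_conn₂ i⟩) := hL φ x
  obtain ⟨V, hV⟩ := exists_continuousLinearMap_of_bound L
    (fun φ φ' => HilbertTensor.ext fun x => by rw [add_apply, hL', hL', hL', D.armTensor_add])
    (fun c φ => HilbertTensor.ext fun x => by rw [smul_apply, hL', hL', D.armTensor_smul]) hn
  exact ⟨V, fun φ x => by rw [hV, hL']⟩

/-- Combination of the systems emitted by the source `some i` with a local system. -/
def armInsert (i : Fin k) : H (D.conn₀ i) →L[ℂ] SourceSpace src H (some i) →L[ℂ]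
    ArmSpace meas H i :=
  (D.exists_armInsert i).choose

theorem armInsert_tprod (i : Fin k) (φ : H (D.conn₀ i))
    (x : ∀ c : {c : ι // src c = some i}, H c.1) :
    D.armInsert i φ (tprod _ x) =
      D.armTensor i φ (x ⟨D.conn₁ i, D.src_conn₁ i⟩) (x ⟨D.conn₂ i, D.src_conn₂ i⟩) :=
  (D.exists_armInsert i).choose_spec φ x

theorem update_comp_conn₀ [DecidableEq {c : ι // src c = none}]
    (x : ∀ c : {c : ι // src c = none}, H c.1) (i : Fin k)
    (z : H (D.conn₀ i)) :
    (fun j => Function.update x ⟨D.conn₀ i, D.src_conn₀ i⟩ z ⟨D.conn₀ j, D.src_conn₀ j⟩) =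
      Function.update (fun j => x ⟨D.conn₀ j, D.src_conn₀ j⟩ : ∀ j, D.Local H j) i z := by
  funext j
  by_cases hj : j = i
  · subst hj
    rw [Function.update_self, Function.update_self]
  · rw [Function.update_of_ne hj, Function.update_of_ne]
    exact fun h => hj (D.noneEquiv.injective h)

/-- The system emitted by the source `none`, with its factors indexed by the arms. -/
def noneMulti : MultilinearMap ℂ (fun c : {c : ι // src c = none} => H c.1)
    (HilbertTensor (D.Local H)) where
  toFun x := tprod (D.Local H) fun i => x ⟨D.conn₀ i, D.src_conn₀ i⟩
  map_update_add' := by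
    intro hdec x c a b
    obtain ⟨i, rfl⟩ := D.exists_eq_conn₀ c
    rw [D.update_comp_conn₀, D.update_comp_conn₀, D.update_comp_conn₀,
      MultilinearMap.map_update_add]
  map_update_smul' := by
    intro hdec x c r a
    obtain ⟨i, rfl⟩ := D.exists_eq_conn₀ c
    rw [D.update_comp_conn₀, D.update_comp_conn₀, MultilinearMap.map_update_smul]

theorem exists_noneMap : ∃ J : SourceSpace src H none →L[ℂ] HilbertTensor (D.Local H),
    ∀ x : ∀ c : {c : ι // src c = none}, H c.1,
      J (tprod _ x) = tprod (D.Local H) fun i => x ⟨D.conn₀ i, D.src_conn₀ i⟩ := by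
  obtain ⟨J, hJ, -⟩ := exists_lift (D.noneMulti (H := H)) 1 zero_le_one fun x y => by
    refine (inner_tprod _ _).trans ?_
    rw [← D.noneEquiv.prod_comp, Complex.ofReal_one, one_pow, one_mul]
    rfl
  exact ⟨J, hJ⟩

/-- The system emitted by the source `none`, with its factors indexed by the arms. -/
def noneMap : SourceSpace src H none →L[ℂ] HilbertTensor (D.Local H) := D.exists_noneMap.choose

theorem noneMap_tprod (x : ∀ c : {c : ι // src c = none}, H c.1) :
    D.noneMap (tprod _ x) = tprod (D.Local H) fun i => x ⟨D.conn₀ i, D.src_conn₀ i⟩ :=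
  D.exists_noneMap.choose_spec x

theorem inner_noneMap_tprod
    (x y : ∀ c : {c : ι // src c = none}, H c.1) :
    ⟪D.noneMap (tprod _ x), D.noneMap (tprod _ y)⟫_ℂ =
      ⟪tprod (fun c : {c : ι // src c = none} => H c.1) x,
        tprod (fun c : {c : ι // src c = none} => H c.1) y⟫_ℂ := by
  rw [D.noneMap_tprod, D.noneMap_tprod, inner_tprod, inner_tprod, ← D.noneEquiv.prod_comp]
  rfl

theorem adjoint_noneMap_comp : (D.noneMap (H := H)).adjoint ∘L D.noneMap = 1 := by
  refine ext_inner fun x y => ?_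
  rw [ContinuousLinearMap.comp_apply, ContinuousLinearMap.adjoint_inner_right,
    D.inner_noneMap_tprod, one_apply_eq_self]

/-- Every simple tensor over the arms is the image of its relabelling along `noneEquiv`. As
`noneMap` is an isometry, the composite fixes its range, hence all simple tensors. -/
theorem noneMap_comp_adjoint : D.noneMap (H := H) ∘L D.noneMap.adjoint = 1 := by
  refine HilbertTensor.ext fun y => ?_
  let x : ∀ c : {c : ι // src c = none}, H c.1 :=
    Equiv.piCongrLeft (fun c : {c : ι // src c = none} => H c.1) D.noneEquiv y
  have hx : y = fun i => x ⟨D.conn₀ i, D.src_conn₀ i⟩ := funext fun i =>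
    (Equiv.piCongrLeft_apply_apply (fun c : {c : ι // src c = none} => H c.1) D.noneEquiv y i).symm
  have h := congrArg (fun T : SourceSpace src H none →L[ℂ] SourceSpace src H none => T (tprod _ x))
    D.adjoint_noneMap_comp
  simp only [ContinuousLinearMap.comp_apply, one_apply_eq_self] at h ⊢
  rw [hx, ← D.noneMap_tprod, h]

theorem norm_noneMap (x : SourceSpace src H none) : ‖D.noneMap x‖ = ‖x‖ := by
  have h := (ContinuousLinearMap.norm_map_iff_adjoint_comp_self (D.noneMap (H := H))).2
    D.adjoint_noneMap_comp
  exact h x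

/-- The systems of all sources, regrouped by arms. -/
def regroup : HilbertTensor (SourceSpace src H) →L[ℂ] HilbertTensor (ArmSpace meas H) :=
  group (H := MeasSpace meas H) arm ∘L group (H := H) meas ∘L
    (group (H := H) src).adjoint

theorem regroup_group_tprod (y : ∀ c, H c) :
    regroup (group src (tprod H y)) =
      tprod (ArmSpace meas H) fun i =>
        D.armTensor i (y (D.conn₀ i)) (y (D.conn₁ i)) (y (D.conn₂ i)) := by
  have h1 : (group src).adjoint
      (group src (tprod H y)) = tprod H y :=
    congrArg (fun T : HilbertTensor H →L[ℂ] HilbertTensor H => T (tprod H y))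
      (adjoint_group_comp_group (H := H) src)
  have h2 : regroup (group src (tprod H y)) =
      group (H := MeasSpace meas H) arm (group (H := H) meas
        ((group src).adjoint
          (group src (tprod H y)))) := rfl
  rw [h2, h1, group_tprod, group_tprod]
  refine congrArg (tprod (ArmSpace meas H)) (funext fun i => ?_)
  exact D.tprod_eq_armTensor i y

/-- This puts products of simple tensors in the range of `group src`, where its adjoint acts as an
inverse. -/
theorem tprod_tprod_eq (x : ∀ s, ∀ c : {c : ι // src c = s}, H c.1) :
    (tprod (SourceSpace src H) fun s =>
      tprod (fun c : {c : ι // src c = s} => H c.1) (x s)) =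
      group src (tprod H fun c => x (src c) ⟨c, rfl⟩) := by
  rw [group_tprod]
  refine congrArg (tprod (SourceSpace src H)) (funext fun s => ?_)
  refine congrArg (tprod fun c : {c : ι // src c = s} => H c.1)
    (funext fun ⟨c, hc⟩ => ?_)
  subst hc
  rfl

end ArmSystem

/-! ### Product vectors of the sources seen from the arms; effective local operators -/

namespace ArmSystem

open HilbertTensor InnerProductSpace

attribute [local irreducible] AlgTensor.form PiTensorProduct.lift HilbertTensor.tprod
  HilbertTensor.map
  HilbertTensor.group

variable {k : ℕ} {ι : Type} [Fintype ι] [DecidableEq ι] {src : ι → Option (Fin k)}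
  {meas : ι → Fin k ⊕ Fin k} (D : ArmSystem src meas) {H : ι → Type u}
    [∀ c, NormedAddCommGroup (H c)]
  [∀ c, InnerProductSpace ℂ (H c)]

/-- The family of vectors emitted by the sources `none` and `some i`. -/
def glue (ξ₀ : SourceSpace src H none) (η : ∀ i : Fin k, SourceSpace src H (some i)) :
    ∀ s, SourceSpace src H s
  | none => ξ₀
  | some i => η i

theorem glue_update_some (ξ₀ : SourceSpace src H none) (η : ∀ i : Fin k, SourceSpace src H (some i))
    (i : Fin k) (z : SourceSpace src H (some i)) :
    glue ξ₀ (Function.update η i z) = Function.update (glue ξ₀ η) (some i) z := by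
  funext s
  cases s with
  | none => exact (Function.update_of_ne (by simp) _ _).symm
  | some j =>
    by_cases hj : j = i
    · subst hj
      rw [Function.update_self]
      exact Function.update_self _ _ _
    · rw [Function.update_of_ne (by simpa using hj)]
      exact Function.update_of_ne hj _ _

theorem glue_none (ξ₀ : SourceSpace src H none) (η : ∀ i : Fin k, SourceSpace src H (some i))
    (z : SourceSpace src H none) : glue z η = Function.update (glue ξ₀ η) none z := by
  funext s
  cases s with
  | none => exact (Function.update_self _ _ _).symm
  | some j => exact (Function.update_of_ne (by simp) _ _).symm

/-- Both sides are bounded and linear in each vector emitted by an arm source, so it suffices to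
take these vectors simple, where the regrouping is a permutation of factors. -/
theorem regroup_glue_tprod
    (x : ∀ c : {c : ι // src c = none}, H c.1)
    (η : ∀ i : Fin k, SourceSpace src H (some i)) :
    regroup (tprod (SourceSpace src H)
      (glue (tprod (fun c : {c : ι // src c = none} => H c.1) x) η)) =
      tprod (ArmSpace meas H) fun i => D.armInsert i (x ⟨D.conn₀ i, D.src_conn₀ i⟩) (η i) := by
  refine ext_slots
    (H := fun (i : Fin k) (c : {c : ι // src c = some i}) => H c.1)
    (f := fun η => regroup (tprod (SourceSpace src H) (glue (tprod
      (fun c : {c : ι // src c = none} => H c.1) x) η)))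
    (g := fun η => tprod (ArmSpace meas H)
      fun i => D.armInsert i (x ⟨D.conn₀ i, D.src_conn₀ i⟩) (η i)) ?_ ?_ ?_ η
  · intro η i
    refine ⟨regroup ∘L slot (H := SourceSpace src H) (glue (tprod
      (fun c : {c : ι // src c = none} => H c.1) x) η) (some i), fun z => ?_⟩
    rw [glue_update_some, ContinuousLinearMap.comp_apply, slot_apply]
  · intro η i
    refine ⟨slot (H := ArmSpace meas H)
      (fun i => D.armInsert i (x ⟨D.conn₀ i, D.src_conn₀ i⟩) (η i)) i ∘L
        D.armInsert i (x ⟨D.conn₀ i, D.src_conn₀ i⟩), fun z => ?_⟩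
    rw [ContinuousLinearMap.comp_apply, slot_apply]
    refine congrArg (tprod (ArmSpace meas H)) (funext fun j => ?_)
    exact Function.apply_update (fun j => D.armInsert j (x ⟨D.conn₀ j, D.src_conn₀ j⟩)) η i z j
  · intro y
    let w : ∀ s, ∀ c : {c : ι // src c = s}, H c.1 := fun s =>
      match s with
      | none => x
      | some i => y i
    have hw : glue (tprod (fun c : {c : ι // src c = none} => H c.1) x)
        (fun i => tprod (fun c : {c : ι // src c = some i} => H c.1) (y i)) =
        fun s => tprod (fun c : {c : ι // src c = s} => H c.1) (w s) := by
      funext s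
      cases s <;> rfl
    have hws (s : Option (Fin k)) (c : ι) (hc : src c = s) : w (src c) ⟨c, rfl⟩ = w s ⟨c, hc⟩ := by
      subst hc
      rfl
    rw [hw, tprod_tprod_eq, D.regroup_group_tprod]
    refine congrArg (tprod (ArmSpace meas H)) (funext fun i => ?_)
    rw [hws _ _ (D.src_conn₀ i), hws _ _ (D.src_conn₁ i), hws _ _ (D.src_conn₂ i),
      D.armInsert_tprod]

/-- Combination of a local system with a fixed vector emitted by the source `some i`. -/
def armPart (i : Fin k) (η : SourceSpace src H (some i)) : D.Local H i →L[ℂ] ArmSpace meas H i :=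
  (D.armInsert i).flip η

theorem norm_armPart_le (i : Fin k) (η : SourceSpace src H (some i)) :
    ‖D.armPart i η‖ ≤ ‖(D.armInsert (H := H) i).flip‖ * ‖η‖ :=
  (D.armInsert (H := H) i).flip.le_opNorm η

/-- Once the vectors of the arm sources are fixed, the regrouping acts on the central vector as a
tensor product of one operator per arm. Both sides are bounded linear in the central vector, which
may therefore be taken simple although it is entangled in general. -/
theorem regroup_tprod (ξ : ∀ s, SourceSpace src H s) :
    regroup (tprod (SourceSpace src H) ξ) =
      map (fun i => D.armPart i (ξ (some i))) (D.noneMap (ξ none)) := by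
  have hξ : ξ = glue (ξ none) fun i => ξ (some i) := by
    funext s
    cases s <;> rfl
  have h : regroup (meas := meas) ∘L slot (H := SourceSpace src H) ξ none =
      map (fun i => D.armPart i (ξ (some i))) ∘L D.noneMap := by
    refine HilbertTensor.ext fun x => ?_
    have h2 := glue_none (ξ none) (fun i => ξ (some i))
      (tprod (fun c : {c : ι // src c = none} => H c.1) x)
    rw [← hξ] at h2
    rw [ContinuousLinearMap.comp_apply, slot_apply, ← h2, D.regroup_glue_tprod,
      ContinuousLinearMap.comp_apply, D.noneMap_tprod, map_tprod]
    rfl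
  have h3 := congrArg
    (fun T : SourceSpace src H none →L[ℂ] HilbertTensor (ArmSpace meas H) => T (ξ none)) h
  simp only [ContinuousLinearMap.comp_apply, slot_apply, Function.update_eq_self] at h3
  exact h3

/-- The measurements of an arm. -/
def armMap (T : ∀ m, MeasSpace meas H m →L[ℂ] MeasSpace meas H m) (i : Fin k) :
    ArmSpace meas H i →L[ℂ] ArmSpace meas H i :=
  map fun m : {m : Fin k ⊕ Fin k // arm m = i} => T m.1

/-- The effective local operator obtained from an operator on an arm and a vector emitted by the
source of that arm. -/
def armOp (i : Fin k) (G : ArmSpace meas H i →L[ℂ] ArmSpace meas H i)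
    (ξ : SourceSpace src H (some i)) [∀ c, CompleteSpace (H c)] :
    D.Local H i →L[ℂ] D.Local H i :=
  (D.armPart i ξ).adjoint ∘L G ∘L D.armPart i ξ

theorem inner_armOp [∀ c, CompleteSpace (H c)] (i : Fin k)
    (G : ArmSpace meas H i →L[ℂ] ArmSpace meas H i) (ξ : SourceSpace src H (some i))
      (φ ψ : D.Local H i) :
    ⟪φ, D.armOp i G ξ ψ⟫_ℂ = ⟪D.armInsert i φ ξ, G (D.armInsert i ψ ξ)⟫_ℂ := by
  rw [armOp, ContinuousLinearMap.comp_apply, ContinuousLinearMap.adjoint_inner_right]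
  rfl

/-- The bound is quadratic in `ξ`, so square summability of an ensemble makes its effective
operators absolutely summable. -/
theorem norm_armOp_le [∀ c, CompleteSpace (H c)] (i : Fin k)
    (G : ArmSpace meas H i →L[ℂ] ArmSpace meas H i) (ξ : SourceSpace src H (some i)) :
    ‖D.armOp i G ξ‖ ≤ ‖(D.armInsert (H := H) i).flip‖ ^ 2 * ‖G‖ * ‖ξ‖ ^ 2 := by
  have h := D.norm_armPart_le i ξ
  have h1 := ContinuousLinearMap.opNorm_comp_le (D.armPart i ξ).adjoint
    (G ∘L D.armPart i ξ)
  have h2 := ContinuousLinearMap.opNorm_comp_le G (D.armPart i ξ)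
  rw [LinearIsometryEquiv.norm_map] at h1
  calc ‖D.armOp i G ξ‖ ≤ ‖D.armPart i ξ‖ * (‖G‖ * ‖D.armPart i ξ‖) :=
        h1.trans (by gcongr)
    _ ≤ (‖(D.armInsert (H := H) i).flip‖ * ‖ξ‖) *
          (‖G‖ * (‖(D.armInsert (H := H) i).flip‖ * ‖ξ‖)) := by gcongr
    _ = _ := by ring

/-- The measurements factorize over arms and so does the insertion of the arm vectors; compressing
each arm's measurement by its insertion leaves a tensor product of local operators on the central
vector. -/
theorem inner_groupMap_meas [∀ c, CompleteSpace (H c)]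
    (T : ∀ m, MeasSpace meas H m →L[ℂ] MeasSpace meas H m) (ξ : ∀ s, SourceSpace src H s) :
    ⟪(group (H := H) src).adjoint (tprod (SourceSpace src H) ξ),
      groupMap (H := H) meas T
        ((group (H := H) src).adjoint (tprod (SourceSpace src H) ξ))⟫_ℂ =
      ⟪D.noneMap (ξ none), map (fun i => D.armOp i (armMap T i) (ξ (some i)))
        (D.noneMap (ξ none))⟫_ℂ := by
  rw [inner_groupMap_eq, inner_map_eq_inner_group arm]
  have h6 : group (H := MeasSpace meas H) arm (group (H := H) meas
      ((group (H := H) src).adjoint (tprod (SourceSpace src H) ξ))) =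
      map (fun i => D.armPart i (ξ (some i))) (D.noneMap (ξ none)) := D.regroup_tprod ξ
  rw [h6]
  exact inner_map_map (G := ArmSpace meas H) (fun i => D.armPart i (ξ (some i))) (armMap T)
    (D.noneMap (ξ none))

/-- The quantum correlations of a multiarm scenario in terms of effective local operators acting on
the state of the source `none`. -/
theorem opTrace_eq [∀ c, CompleteSpace (H c)]
    (T : ∀ m, MeasSpace meas H m →L[ℂ] MeasSpace meas H m)
    (ρ : ∀ s, SourceSpace src H s →L[ℂ] SourceSpace src H s) {α : Option (Fin k) → Type u}
    (ξ : ∀ s, α s → SourceSpace src H s) (hξ : ∀ s, IsEnsemble (ρ s) (ξ s))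
    (B : ∀ i, D.Local H i →L[ℂ] D.Local H i)
    (hB : ∀ i, HasSum (fun n => D.armOp i (armMap T i) (ξ (some i) n)) (B i)) :
    opTrace (groupMap (H := H) src ρ ∘L
      groupMap (H := H) meas T) =
      opTrace ((D.noneMap ∘L ρ none ∘L D.noneMap.adjoint) ∘L map B) := by
  have hn (i : Fin k) : Summable fun n => ‖D.armOp i (armMap T i) (ξ (some i) n)‖ :=
    Summable.of_nonneg_of_le (fun _ => norm_nonneg _) (fun n => D.norm_armOp_le i _ _)
      ((hξ (some i)).summable.mul_left _)
  -- The product ensemble is indexed by a central index and a tuple of arm indices. Summing over the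
  -- tuple first turns the effective operators into the `B i`.
  let e : (α none × ∀ i, α (some i)) ≃ ∀ s, α s := Equiv.piOptionEquivProd.symm
  refine opTrace_eq_of_inner_eq ((isEnsemble_groupMap src hξ).comp_equiv e)
    ((hξ none).map D.noneMap) (hasSum_map hB hn) fun q => ?_
  exact D.inner_groupMap_meas T fun s => ξ s (e q s)

end ArmSystem

/-! ### Averaging out the sources of the arms in a quantum model -/

namespace ArmSystem

open HilbertTensor InnerProductSpace

attribute [local irreducible] AlgTensor.form PiTensorProduct.lift HilbertTensor.tprod
  HilbertTensor.map
  HilbertTensor.group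

variable {k : ℕ} {ι : Type} [Fintype ι] [DecidableEq ι] {src : ι → Option (Fin k)}
  {meas : ι → Fin k ⊕ Fin k} (D : ArmSystem src meas) {H : ι → Type u}
  [∀ c, NormedAddCommGroup (H c)] [∀ c, InnerProductSpace ℂ (H c)]

/-- The tensor product of operators of the two measurements of an arm. -/
def armPair (i : Fin k) (S : MeasSpace meas H (.inl i) →L[ℂ] MeasSpace meas H (.inl i))
    (R : MeasSpace meas H (.inr i) →L[ℂ] MeasSpace meas H (.inr i)) :
    ArmSpace meas H i →L[ℂ] ArmSpace meas H i :=
  armMap (Function.update (Function.update (fun _ => 1) (.inl i) S) (.inr i) R) i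

theorem inner_armMap (T : ∀ m, MeasSpace meas H m →L[ℂ] MeasSpace meas H m) (i : Fin k)
    (x y : ∀ m : {m // arm m = i}, MeasSpace meas H m.1) :
    ⟪tprod (fun m : {m // arm m = i} => MeasSpace meas H m.1) x,
      armMap T i (tprod (fun m : {m // arm m = i} => MeasSpace meas H m.1) y)⟫_ℂ =
      ⟪x ⟨.inl i, arm_inl i⟩, T (.inl i) (y ⟨.inl i, arm_inl i⟩)⟫_ℂ *
        ⟪x ⟨.inr i, arm_inr i⟩, T (.inr i) (y ⟨.inr i, arm_inr i⟩)⟫_ℂ := by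
  rw [armMap, inner_map_tprod, (isPair_arm i).prod_eq]

theorem inner_armPair (i : Fin k) (S : MeasSpace meas H (.inl i) →L[ℂ] MeasSpace meas H (.inl i))
    (R : MeasSpace meas H (.inr i) →L[ℂ] MeasSpace meas H (.inr i))
    (x y : ∀ m : {m // arm m = i}, MeasSpace meas H m.1) :
    ⟪tprod (fun m : {m // arm m = i} => MeasSpace meas H m.1) x,
      armPair i S R (tprod (fun m : {m // arm m = i} => MeasSpace meas H m.1) y)⟫_ℂ =
      ⟪x ⟨.inl i, arm_inl i⟩, S (y ⟨.inl i, arm_inl i⟩)⟫_ℂ *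
        ⟪x ⟨.inr i, arm_inr i⟩, R (y ⟨.inr i, arm_inr i⟩)⟫_ℂ := by
  rw [armPair, inner_armMap, Function.update_self, Function.update_of_ne Sum.inl_ne_inr,
    Function.update_self]

theorem armMap_eq (T : ∀ m, MeasSpace meas H m →L[ℂ] MeasSpace meas H m) (i : Fin k) :
    armMap T i = armPair i (T (.inl i)) (T (.inr i)) := by
  refine ext_inner fun x y => ?_
  rw [inner_armMap, inner_armPair]

theorem sum_armPair {O : Type*} [Fintype O] (i : Fin k)
    (S : O → MeasSpace meas H (.inl i) →L[ℂ] MeasSpace meas H (.inl i))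
    (R : MeasSpace meas H (.inr i) →L[ℂ] MeasSpace meas H (.inr i)) :
    ∑ o, armPair i (S o) R = armPair i (∑ o, S o) R := by
  refine ext_inner fun x y => ?_
  rw [inner_armPair, sum_apply, sum_apply, inner_sum,
    inner_sum, Finset.sum_mul]
  exact Finset.sum_congr rfl fun o _ => inner_armPair i (S o) R x y

theorem isPositive_armPair (i : Fin k)
    {S : MeasSpace meas H (.inl i) →L[ℂ] MeasSpace meas H (.inl i)}
    {R : MeasSpace meas H (.inr i) →L[ℂ] MeasSpace meas H (.inr i)} (hS : S.IsPositive)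
    (hR : R.IsPositive) : (armPair i S R).IsPositive := by
  rw [armPair, armMap]
  refine isPositive_map _ fun m => ?_
  rcases (isPair_arm i).eq_or_eq m with rfl | rfl
  · rw [Function.update_of_ne Sum.inl_ne_inr, Function.update_self]
    exact hS
  · rw [Function.update_self]
    exact hR

theorem inner_armTensor_armPair (i : Fin k)
    (S : MeasSpace meas H (.inl i) →L[ℂ] MeasSpace meas H (.inl i))
    (R : MeasSpace meas H (.inr i) →L[ℂ] MeasSpace meas H (.inr i)) (φ φ' : H (D.conn₀ i))
    (a a' : H (D.conn₁ i)) (b b' : H (D.conn₂ i)) :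
    ⟪D.armTensor i φ a b, armPair i S R (D.armTensor i φ' a' b')⟫_ℂ =
      ⟪pair (H := fun c : {c : ι // meas c = .inl i} => H c.1)
          ⟨D.conn₀ i, D.meas_conn₀ i⟩ ⟨D.conn₁ i, D.meas_conn₁ i⟩ φ a,
        S (pair (H := fun c : {c : ι // meas c = .inl i} => H c.1)
          ⟨D.conn₀ i, D.meas_conn₀ i⟩ ⟨D.conn₁ i, D.meas_conn₁ i⟩ φ' a')⟫_ℂ *
      ⟪single (H := fun c : {c : ι // meas c = .inr i} => H c.1) ⟨D.conn₂ i, D.meas_conn₂ i⟩ b,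
        R (single (H := fun c : {c : ι // meas c = .inr i} => H c.1)
          ⟨D.conn₂ i, D.meas_conn₂ i⟩ b')⟫_ℂ := by
  rw [armTensor, armTensor, armPair, armMap, map_pair (isPair_arm i), inner_pair (isPair_arm i),
    Function.update_self, Function.update_of_ne Sum.inl_ne_inr, Function.update_self]

variable [∀ c, CompleteSpace (H c)]

/-- If the measurement `inl i` is ignored, then the measurement `inr i` acts only on the systems of
the source `some i`. -/
theorem exists_inner_armInsert (i : Fin k)
    {R : MeasSpace meas H (.inr i) →L[ℂ] MeasSpace meas H (.inr i)} (hR : R.IsPositive) :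
    ∃ E : SourceSpace src H (some i) →L[ℂ] SourceSpace src H (some i), E.IsPositive ∧
      ∀ (φ ψ : D.Local H i) (ξ : SourceSpace src H (some i)),
        ⟪D.armInsert i φ ξ, armPair i 1 R (D.armInsert i ψ ξ)⟫_ℂ = ⟪φ, ψ⟫_ℂ * ⟪ξ, E ξ⟫_ℂ := by
  -- `S` regards the only system of the measurement `inr i` as a one-factor tensor. The required `E`
  -- compresses `R` by `S` on the second system of the source and is the identity on the first.
  let S : H (D.conn₂ i) →L[ℂ] MeasSpace meas H (.inr i) :=
    slot (H := fun c : {c : ι // meas c = .inr i} => H c.1) 0 ⟨D.conn₂ i, D.meas_conn₂ i⟩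
  let T : ∀ c : {c : ι // src c = some i}, H c.1 →L[ℂ] H c.1 :=
    Function.update (fun _ => 1) ⟨D.conn₂ i, D.src_conn₂ i⟩ (S.adjoint ∘L R ∘L S)
  have hT₁ : T ⟨D.conn₁ i, D.src_conn₁ i⟩ = 1 := Function.update_of_ne (D.isPair_some i).ne _ _
  have hT₂ : T ⟨D.conn₂ i, D.src_conn₂ i⟩ = S.adjoint ∘L R ∘L S := Function.update_self _ _ _
  refine ⟨map T, isPositive_map _ fun c => ?_, fun φ ψ ξ => ?_⟩
  · rcases (D.isPair_some i).eq_or_eq c with rfl | rfl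
    · rw [hT₁]
      exact ContinuousLinearMap.isPositive_one
    · rw [hT₂]
      exact hR.adjoint_conj S
  · have h : (D.armInsert i φ).adjoint ∘L armPair i 1 R ∘L D.armInsert i ψ = ⟪φ, ψ⟫_ℂ • map T := by
      refine ext_inner fun x y => ?_
      rw [ContinuousLinearMap.comp_apply, ContinuousLinearMap.adjoint_inner_right,
        ContinuousLinearMap.comp_apply, D.armInsert_tprod, D.armInsert_tprod,
        D.inner_armTensor_armPair, smul_apply, inner_smul_right, inner_map_tprod,
        (D.isPair_some i).prod_eq, hT₁, hT₂, one_apply_eq_self, one_apply_eq_self,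
        inner_pair (D.isPair_inl i), ContinuousLinearMap.comp_apply,
        ContinuousLinearMap.adjoint_inner_right, mul_assoc]
      rfl
    have h1 := congrArg (fun A : SourceSpace src H (some i) →L[ℂ] SourceSpace src H (some i) =>
      ⟪ξ, A ξ⟫_ℂ) h
    simp only [ContinuousLinearMap.comp_apply, ContinuousLinearMap.adjoint_inner_right,
      smul_apply, inner_smul_right] at h1
    exact h1

theorem isPositive_armOp (i : Fin k) {G : ArmSpace meas H i →L[ℂ] ArmSpace meas H i}
    (hG : G.IsPositive) (ξ : SourceSpace src H (some i)) : (D.armOp i G ξ).IsPositive :=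
  isPositive_of_inner_nonneg fun φ => by
    rw [D.inner_armOp]
    exact hG.inner_nonneg_right _

theorem summable_armOp (i : Fin k) (G : ArmSpace meas H i →L[ℂ] ArmSpace meas H i) {α : Type*}
    {ξ : α → SourceSpace src H (some i)} (h : Summable fun n => ‖ξ n‖ ^ 2) :
    Summable fun n => D.armOp i G (ξ n) := by
  refine Summable.of_norm (Summable.of_nonneg_of_le (fun _ => norm_nonneg _)
    (fun n => D.norm_armOp_le i G (ξ n)) (h.mul_left _))

/-- Summing over the outcomes replaces the measurement `inl i` by the identity. The remaining form
is `⟪φ, ψ⟫` times a number depending only on the arm source and `R`, and averaging over the ensemble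
gives `N = tr(ρE)`. -/
theorem inner_sum_armOp {α : Type*} {O : Type*} [Fintype O] (i : Fin k)
    {ρ : SourceSpace src H (some i) →L[ℂ] SourceSpace src H (some i)}
    {ξ : α → SourceSpace src H (some i)} (h : IsEnsemble ρ ξ)
    {S : O → MeasSpace meas H (.inl i) →L[ℂ] MeasSpace meas H (.inl i)} (hS : ∑ o, S o = 1)
    {R : MeasSpace meas H (.inr i) →L[ℂ] MeasSpace meas H (.inr i)} (hR : R.IsPositive) :
    ∃ N : ℝ, 0 ≤ N ∧ ∑ o, ∑' n, D.armOp i (armPair i (S o) R) (ξ n) =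
      (N : ℂ) • (1 : D.Local H i →L[ℂ] D.Local H i) := by
  obtain ⟨E, hE, hER⟩ := D.exists_inner_armInsert i hR
  have hN := h.hasSum_opTrace E
  have h0 : 0 ≤ opTrace (ρ ∘L E) := hN.nonneg fun n => hE.inner_nonneg_right _
  refine ⟨(opTrace (ρ ∘L E)).re, (Complex.nonneg_iff.1 h0).1, ?_⟩
  have hre : (((opTrace (ρ ∘L E)).re : ℝ) : ℂ) = opTrace (ρ ∘L E) :=
    Complex.ext rfl (Complex.nonneg_iff.1 h0).2
  rw [hre]
  refine continuousLinearMap_ext_inner fun φ ψ => ?_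
  rw [smul_apply, inner_smul_right, one_apply_eq_self, sum_apply, inner_sum]
  have h1 (o : O) : HasSum (fun n => ⟪D.armInsert i φ (ξ n),
      armPair i (S o) R (D.armInsert i ψ (ξ n))⟫_ℂ)
      ⟪φ, (∑' n, D.armOp i (armPair i (S o) R) (ξ n)) ψ⟫_ℂ := by
    have h2 := ContinuousLinearMap.hasSum_inner
      (D.summable_armOp i (armPair i (S o) R) h.summable).hasSum φ ψ
    simpa only [D.inner_armOp] using h2
  have h3 := hasSum_sum fun o (_ : o ∈ Finset.univ) => h1 o
  refine h3.unique ?_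
  have h4 := hN.mul_left ⟪φ, ψ⟫_ℂ
  rw [mul_comm]
  refine h4.congr_fun fun n => ?_
  rw [← hER, ← hS, ← sum_armPair, sum_apply, inner_sum]

/-- The effective measurements on the systems of the source `none`. -/
theorem exists_effective {O : Fin k ⊕ Fin k → Type v} [∀ m, Fintype (O m)]
    (ρ : ∀ s, SourceSpace src H s →L[ℂ] SourceSpace src H s) (hρ : ∀ s, IsState (ρ s))
    (F : ∀ m, O m → MeasSpace meas H m →L[ℂ] MeasSpace meas H m) (hF : ∀ m, IsPOVM (F m)) :
    ∃ (σ : HilbertTensor (D.Local H) →L[ℂ] HilbertTensor (D.Local H))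
      (B : ∀ i, O (.inr i) → O (.inl i) → D.Local H i →L[ℂ] D.Local H i)
      (N : ∀ i, O (.inr i) → ℝ),
      IsState σ ∧ (∀ i x a, (B i x a).IsPositive) ∧ (∀ i x, 0 ≤ N i x) ∧
      (∀ i x, ∑ a, B i x a = (N i x : ℂ) • (1 : D.Local H i →L[ℂ] D.Local H i)) ∧
      ∀ v : ∀ m, O m, opTrace (groupMap (H := H) src ρ ∘L groupMap (H := H) meas
        fun m => F m (v m)) = opTrace (σ ∘L map fun i => B i (v (.inr i)) (v (.inl i))) := by
  choose α ξ hξ using fun s => (hρ s).exists_isEnsemble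
  choose N hN₀ hN using fun i x => D.inner_sum_armOp i (hξ (some i)) (hF (.inl i)).2
    ((hF (.inr i)).1 x)
  refine ⟨D.noneMap ∘L ρ none ∘L D.noneMap.adjoint,
    fun i x a => ∑' n, D.armOp i (armPair i (F (.inl i) a) (F (.inr i) x)) (ξ (some i) n), N,
    ?_, fun i x a => ?_, hN₀, hN, fun v => ?_⟩
  -- An isometry preserves the total square norm of the ensemble, hence the unit trace.
  · rw [((hξ none).map D.noneMap).isState_iff]
    simp only [D.norm_noneMap]
    exact ((hξ none).isState_iff).1 (hρ none)
  · exact isPositive_of_hasSum (D.summable_armOp i _ (hξ (some i)).summable).hasSum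
      fun n => D.isPositive_armOp i (isPositive_armPair i ((hF _).1 a) ((hF _).1 x)) _
  · refine D.opTrace_eq _ ρ ξ hξ _ fun i => ?_
    rw [armMap_eq]
    exact (D.summable_armOp i _ (hξ (some i)).summable).hasSum

end ArmSystem

/-! ### A quantum multiarm model built from a Bell model -/

namespace ArmSystem

open HilbertTensor InnerProductSpace

attribute [local irreducible] AlgTensor.form PiTensorProduct.lift HilbertTensor.tprod
  HilbertTensor.map
  HilbertTensor.group

variable {k : ℕ} {ι : Type} [Fintype ι] [DecidableEq ι] {src : ι → Option (Fin k)}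
  {meas : ι → Fin k ⊕ Fin k} (D : ArmSystem src meas) {H : ι → Type u}
  [∀ c, NormedAddCommGroup (H c)] [∀ c, InnerProductSpace ℂ (H c)] [∀ c, CompleteSpace (H c)]
  {X : Fin k → Type u} [∀ i, Fintype (X i)]
  (e₁ : ∀ i, OrthonormalBasis (X i) ℂ (H (D.conn₁ i)))
  (e₂ : ∀ i, OrthonormalBasis (X i) ℂ (H (D.conn₂ i)))

theorem sum_rankOne_eq_one {V : Type u} [NormedAddCommGroup V] [InnerProductSpace ℂ V] {J : Type u}
    [Fintype J] (b : OrthonormalBasis J ℂ V) : ∑ j, rankOne ℂ (b j) (b j) = 1 := by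
  ext x
  rw [sum_apply, one_apply_eq_self]
  exact b.sum_repr' x

/-- The vectors `√w(x) |x⟩|x⟩`. -/
def armVec (w : ∀ i, X i → ℝ) (i : Fin k) (x : X i) : SourceSpace src H (some i) :=
  ((Real.sqrt (w i x) : ℝ) : ℂ) • pair (H := fun c : {c : ι // src c = some i} => H c.1)
    ⟨D.conn₁ i, D.src_conn₁ i⟩ ⟨D.conn₂ i, D.src_conn₂ i⟩ (e₁ i x) (e₂ i x)

theorem norm_sq_armVec {w : ∀ i, X i → ℝ} (hw : ∀ i x, 0 ≤ w i x) (i : Fin k) (x : X i) :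
    ‖D.armVec e₁ e₂ w i x‖ ^ 2 = w i x := by
  have h1 : ‖pair (H := fun c : {c : ι // src c = some i} => H c.1)
    ⟨D.conn₁ i, D.src_conn₁ i⟩ ⟨D.conn₂ i, D.src_conn₂ i⟩ (e₁ i x) (e₂ i x)‖ ^ 2 = 1 := by
    refine Complex.ofReal_injective ?_
    have h2 := inner_pair (D.isPair_some i) (H := fun c : {c : ι // src c = some i} => H c.1)
      (e₁ i x) (e₁ i x) (e₂ i x) (e₂ i x)
    rw [inner_self_eq_norm_sq_to_K, inner_self_eq_norm_sq_to_K, inner_self_eq_norm_sq_to_K] at h2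
    push_cast
    refine h2.trans ?_
    rw [(e₁ i).orthonormal.1 x, (e₂ i).orthonormal.1 x]
    simp
  rw [armVec, norm_smul, mul_pow, h1, mul_one, Complex.norm_real, Real.norm_eq_abs, sq_abs,
    Real.sq_sqrt (hw i x)]

theorem armInsert_armVec (w : ∀ i, X i → ℝ) (i : Fin k) (x : X i) (φ : D.Local H i) :
    D.armInsert i φ (D.armVec e₁ e₂ w i x) =
      ((Real.sqrt (w i x) : ℝ) : ℂ) • D.armTensor i φ (e₁ i x) (e₂ i x) := by
  rw [armVec, _root_.map_smul, pair, D.armInsert_tprod, Function.update_self,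
    Function.update_of_ne (D.isPair_some i).ne, Function.update_self]

/-- The state `∑ₓ w(x) |xx⟩⟨xx|` of the source `some i`, and a given state of the source `none`. -/
def bellStates (σ : HilbertTensor (D.Local H) →L[ℂ] HilbertTensor (D.Local H))
    (w : ∀ i, X i → ℝ) : ∀ s, SourceSpace src H s →L[ℂ] SourceSpace src H s
  | none => D.noneMap.adjoint ∘L σ ∘L D.noneMap
  | some i => ∑ x, rankOne ℂ (D.armVec e₁ e₂ w i x) (D.armVec e₁ e₂ w i x)

theorem isEnsemble_bellStates_some
    (σ : HilbertTensor (D.Local H) →L[ℂ] HilbertTensor (D.Local H)) (w : ∀ i, X i → ℝ)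
    (i : Fin k) : IsEnsemble (D.bellStates e₁ e₂ σ w (some i)) (D.armVec e₁ e₂ w i) :=
  ⟨(hasSum_fintype _).summable, hasSum_fintype _⟩

theorem norm_adjoint_noneMap (z : HilbertTensor (D.Local H)) :
    ‖(D.noneMap (H := H)).adjoint z‖ = ‖z‖ := by
  rw [← D.norm_noneMap]
  exact congrArg (fun T : HilbertTensor (D.Local H) →L[ℂ] HilbertTensor (D.Local H) => ‖T z‖)
    D.noneMap_comp_adjoint

theorem isEnsemble_bellStates_none {α : Type u}
    {σ : HilbertTensor (D.Local H) →L[ℂ] HilbertTensor (D.Local H)} (w : ∀ i, X i → ℝ)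
    {ξ : α → HilbertTensor (D.Local H)} (hξ : IsEnsemble σ ξ) :
    IsEnsemble (D.bellStates e₁ e₂ σ w none) fun n => D.noneMap.adjoint (ξ n) := by
  have h := hξ.map D.noneMap.adjoint
  rw [ContinuousLinearMap.adjoint_adjoint] at h
  exact h

/-- The central ensemble keeps its norms under the adjoint of `noneMap`; in arm `i` the square norms
are the weights `w i x`. -/
theorem isState_bellStates {σ : HilbertTensor (D.Local H) →L[ℂ] HilbertTensor (D.Local H)}
    (hσ : IsState σ) {w : ∀ i, X i → ℝ} (hw : ∀ i x, 0 ≤ w i x) (hw' : ∀ i, ∑ x, w i x = 1) :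
    ∀ s, IsState (D.bellStates e₁ e₂ σ w s)
  | none => by
    obtain ⟨α, ξ, hξ⟩ := hσ.exists_isEnsemble
    rw [(D.isEnsemble_bellStates_none e₁ e₂ w hξ).isState_iff]
    simp only [D.norm_adjoint_noneMap]
    exact hξ.isState_iff.1 hσ
  | some i => by
    rw [(D.isEnsemble_bellStates_some e₁ e₂ σ w i).isState_iff]
    simp only [D.norm_sq_armVec e₁ e₂ hw]
    rw [← hw' i]
    exact hasSum_fintype _

/-! ### Measurements that read off or announce the setting -/

section Measurements

variable {O : Fin k ⊕ Fin k → Type v} [∀ m, Fintype (O m)] [∀ m, DecidableEq (O m)]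
  (A : ∀ i, X i → O (.inl i) → D.Local H i →L[ℂ] D.Local H i) (g : ∀ i, X i → O (.inr i))

/-- The measurement `inl i` reads off the setting `x` and performs the measurement `A i x`, and the
measurement `inr i` announces the setting. -/
def bellPOVMs : ∀ m, O m → MeasSpace meas H m →L[ℂ] MeasSpace meas H m
  | .inl i => fun a => ∑ x, pairMap (H := fun c : {c : ι // meas c = .inl i} => H c.1)
      ⟨D.conn₀ i, D.meas_conn₀ i⟩ ⟨D.conn₁ i, D.meas_conn₁ i⟩ (A i x a)
      (rankOne ℂ (e₁ i x) (e₁ i x))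
  | .inr i => fun y => singleMap (H := fun c : {c : ι // meas c = .inr i} => H c.1)
      ⟨D.conn₂ i, D.meas_conn₂ i⟩ (∑ x, if g i x = y then rankOne ℂ (e₂ i x) (e₂ i x) else 0)

/-- For `inl i`, summing over outcomes first gives the identity for each setting, and the basis
projections then sum to the identity. For `inr i`, each basis projection is assigned to exactly one
announced value. -/
theorem isPOVM_bellPOVMs (hA : ∀ i x, IsPOVM (A i x)) :
    ∀ m, IsPOVM (D.bellPOVMs e₁ e₂ A g m)
  | .inl i => by
    refine ⟨fun a => ContinuousLinearMap.isPositive_sum _ fun x _ =>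
      isPositive_pairMap (D.isPair_inl i) ((hA i x).1 a) (isPositive_rankOne_self _), ?_⟩
    refine ext_inner fun y z => ?_
    have h (a : O (.inl i)) : ⟪tprod (fun c : {c : ι // meas c = .inl i} => H c.1) y,
        D.bellPOVMs e₁ e₂ A g (.inl i) a
          (tprod (fun c : {c : ι // meas c = .inl i} => H c.1) z)⟫_ℂ =
        ∑ x, ⟪y ⟨D.conn₀ i, D.meas_conn₀ i⟩, A i x a (z ⟨D.conn₀ i, D.meas_conn₀ i⟩)⟫_ℂ *
          ⟪y ⟨D.conn₁ i, D.meas_conn₁ i⟩,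
            rankOne ℂ (e₁ i x) (e₁ i x) (z ⟨D.conn₁ i, D.meas_conn₁ i⟩)⟫_ℂ := by
      rw [bellPOVMs, sum_apply, inner_sum]
      exact Finset.sum_congr rfl fun x _ => inner_pairMap_tprod (D.isPair_inl i) _ _ _ _
    rw [sum_apply, inner_sum, Finset.sum_congr rfl fun a _ => h a, Finset.sum_comm]
    simp only [← Finset.sum_mul, ← inner_sum, ← sum_apply, (hA i _).2]
    rw [← Finset.mul_sum, ← inner_sum, ← sum_apply, sum_rankOne_eq_one, one_apply_eq_self,
      one_apply_eq_self, one_apply_eq_self, inner_tprod, (D.isPair_inl i).prod_eq]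
  | .inr i => by
    refine ⟨fun y => isPositive_singleMap (D.eq_conn₂ i) ?_, ?_⟩
    · refine ContinuousLinearMap.isPositive_sum _ fun x _ => ?_
      split_ifs
      · exact isPositive_rankOne_self _
      · exact ContinuousLinearMap.isPositive_zero
    · refine ext_inner fun y z => ?_
      have h (o : O (.inr i)) : ⟪tprod (fun c : {c : ι // meas c = .inr i} => H c.1) y,
          D.bellPOVMs e₁ e₂ A g (.inr i) o
            (tprod (fun c : {c : ι // meas c = .inr i} => H c.1) z)⟫_ℂ =
          ⟪y ⟨D.conn₂ i, D.meas_conn₂ i⟩,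
            (∑ x, if g i x = o then rankOne ℂ (e₂ i x) (e₂ i x) else 0)
              (z ⟨D.conn₂ i, D.meas_conn₂ i⟩)⟫_ℂ :=
        inner_singleMap_tprod (D.eq_conn₂ i) _ _ _
      rw [sum_apply, inner_sum, Finset.sum_congr rfl fun a _ => h a, ← inner_sum, ← sum_apply,
        Finset.sum_comm]
      simp only [Finset.sum_ite_eq, Finset.mem_univ, if_true]
      rw [sum_rankOne_eq_one, one_apply_eq_self, one_apply_eq_self, inner_tprod,
        prod_eq_of_forall_eq (D.eq_conn₂ i)]

/-- On `√w(x) |xx⟩` orthonormality removes every other setting: `inl i` contributes the operator for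
`x`, `inr i` tests whether the announcement is right, and the two square roots combine to `w(x)`. -/
theorem inner_armOp_bellPOVMs {w : ∀ i, X i → ℝ} (hw : ∀ i x, 0 ≤ w i x) (v : ∀ m, O m)
    (i : Fin k) (x : X i) (φ ψ : D.Local H i) :
    ⟪φ, D.armOp i (armMap (fun m => D.bellPOVMs e₁ e₂ A g m (v m)) i)
      (D.armVec e₁ e₂ w i x) ψ⟫_ℂ =
      if g i x = v (.inr i) then (w i x : ℂ) * ⟪φ, A i x (v (.inl i)) ψ⟫_ℂ else 0 := by
  classical
  rw [D.inner_armOp, armMap_eq, D.armInsert_armVec, D.armInsert_armVec, inner_smul_left,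
    _root_.map_smul, inner_smul_right, D.inner_armTensor_armPair, ← mul_assoc, Complex.conj_ofReal,
    ← Complex.ofReal_mul, Real.mul_self_sqrt (hw i x)]
  have h1 : ⟪pair (H := fun c : {c : ι // meas c = .inl i} => H c.1)
      ⟨D.conn₀ i, D.meas_conn₀ i⟩ ⟨D.conn₁ i, D.meas_conn₁ i⟩ φ (e₁ i x),
      D.bellPOVMs e₁ e₂ A g (.inl i) (v (.inl i))
        (pair (H := fun c : {c : ι // meas c = .inl i} => H c.1)
        ⟨D.conn₀ i, D.meas_conn₀ i⟩ ⟨D.conn₁ i, D.meas_conn₁ i⟩ ψ (e₁ i x))⟫_ℂ =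
      ⟪φ, A i x (v (.inl i)) ψ⟫_ℂ := by
    rw [bellPOVMs, sum_apply, inner_sum, Finset.sum_eq_single x]
    · rw [inner_pairMap_pair (D.isPair_inl i), rankOne_apply, inner_smul_right,
        orthonormal_iff_ite.1 (e₁ i).orthonormal x x]
      simp
    · intro y _ hy
      rw [inner_pairMap_pair (D.isPair_inl i), rankOne_apply, inner_smul_right,
        orthonormal_iff_ite.1 (e₁ i).orthonormal y x, if_neg hy]
      simp
    · exact fun h => absurd (Finset.mem_univ x) h
  have h2 : ⟪single (H := fun c : {c : ι // meas c = .inr i} => H c.1)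
      ⟨D.conn₂ i, D.meas_conn₂ i⟩ (e₂ i x), D.bellPOVMs e₁ e₂ A g (.inr i) (v (.inr i))
        (single (H := fun c : {c : ι // meas c = .inr i} => H c.1)
      ⟨D.conn₂ i, D.meas_conn₂ i⟩ (e₂ i x))⟫_ℂ = if g i x = v (.inr i) then 1 else 0 := by
    rw [bellPOVMs, inner_singleMap_single (D.eq_conn₂ i), sum_apply, inner_sum,
      Finset.sum_eq_single x]
    · split_ifs
      · rw [rankOne_apply, inner_smul_right, orthonormal_iff_ite.1 (e₂ i).orthonormal x x]
        simp
      · simp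
    · intro y _ hy
      split_ifs
      · rw [rankOne_apply, orthonormal_iff_ite.1 (e₂ i).orthonormal y x, if_neg hy]
        simp
      · simp
    · exact fun h => absurd (Finset.mem_univ x) h
  rw [h1, h2]
  split_ifs <;> simp

/-- The correlations of the multiarm scenario obtained from a Bell scenario by letting the source
`some i` generate the setting of the party `i`. -/
theorem opTrace_bell {σ : HilbertTensor (D.Local H) →L[ℂ] HilbertTensor (D.Local H)}
    (hσ : IsState σ) {w : ∀ i, X i → ℝ} (hw : ∀ i x, 0 ≤ w i x) (v : ∀ m, O m) :
    opTrace (groupMap (H := H) src (D.bellStates e₁ e₂ σ w) ∘L groupMap (H := H) meas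
      fun m => D.bellPOVMs e₁ e₂ A g m (v m)) =
      opTrace (σ ∘L map fun i =>
        ∑ x, if g i x = v (.inr i) then (w i x : ℂ) • A i x (v (.inl i)) else 0) := by
  obtain ⟨β, ξ, hξ⟩ := hσ.exists_isEnsemble
  let α : Option (Fin k) → Type u := fun s => match s with
    | none => β
    | some i => X i
  let ζ : ∀ s, α s → SourceSpace src H s := fun s => match s with
    | none => fun n => D.noneMap.adjoint (ξ n)
    | some i => D.armVec e₁ e₂ w i
  have hζ : ∀ s, IsEnsemble (D.bellStates e₁ e₂ σ w s) (ζ s)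
    | none => D.isEnsemble_bellStates_none e₁ e₂ w hξ
    | some i => D.isEnsemble_bellStates_some e₁ e₂ σ w i
  -- Here surjectivity of `noneMap` matters: carrying `σ` to the source space and back returns `σ`.
  have hσ' : D.noneMap ∘L D.bellStates e₁ e₂ σ w none ∘L D.noneMap.adjoint = σ := by
    refine continuousLinearMap_ext_inner fun x y => ?_
    have h (z : HilbertTensor (D.Local H)) : D.noneMap (D.noneMap.adjoint z) = z :=
      congrArg (fun T : HilbertTensor (D.Local H) →L[ℂ] HilbertTensor (D.Local H) => T z)
        D.noneMap_comp_adjoint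
    simp only [bellStates, ContinuousLinearMap.comp_apply, h]
  have hs (i : Fin k) : HasSum (fun n : X i => D.armOp i
      (armMap (fun m => D.bellPOVMs e₁ e₂ A g m (v m)) i) (D.armVec e₁ e₂ w i n))
      (∑ x, if g i x = v (.inr i) then (w i x : ℂ) • A i x (v (.inl i)) else 0) := by
    convert hasSum_fintype _ using 1
    refine Finset.sum_congr rfl fun x _ => continuousLinearMap_ext_inner fun φ ψ => ?_
    rw [D.inner_armOp_bellPOVMs e₁ e₂ A g hw]
    split_ifs
    · rw [smul_apply, inner_smul_right]
    · simp
  rw [D.opTrace_eq _ _ ζ hζ _ hs, hσ']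

end Measurements

end ArmSystem

/-! ### The distribution of the settings -/

section Settings

open scoped Classical in
-- As `U` and `V` cover all coordinates, each `w'` contributing to a marginal on `V` determines a
-- single `w` that agrees with it on `V` and with `v` off `V`. So no term is counted twice.
theorem sum_marginal {M : Type} [Fintype M] [DecidableEq M] {out : M → Type v}
    [∀ m, Fintype (out m)] (p : (∀ m, out m) → ℝ) (U V : Set M) (hUV : U ∪ V = Set.univ)
    (v : ∀ m, out m) :
    ∑ w, (if ∀ m ∈ U, w m = v m then marginal p V w else 0) = marginal p (U ∩ V) v := by
  have h (w' w : ∀ m, out m) : ((∀ m ∈ U, w m = v m) ∧ ∀ m ∈ V, w' m = w m) ↔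
      w = (fun m => if m ∈ V then w' m else v m) ∧ ∀ m ∈ U ∩ V, w' m = v m := by
    constructor
    · rintro ⟨h1, h2⟩
      refine ⟨funext fun m => ?_, fun m hm => (h2 m hm.2).trans (h1 m hm.1)⟩
      split_ifs with hm
      · exact (h2 m hm).symm
      · exact h1 m ((Set.eq_univ_iff_forall.1 hUV m).resolve_right hm)
    · rintro ⟨rfl, h2⟩
      refine ⟨fun m hm => ?_, fun m hm => ?_⟩
      · by_cases hm' : m ∈ V
        · simpa [hm'] using h2 m ⟨hm, hm'⟩
        · simp [hm']
      · simp [hm]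
  have h1 : ∀ w : ∀ m, out m, (if ∀ m ∈ U, w m = v m then marginal p V w else 0) =
      ∑ w', if w = (fun m => if m ∈ V then w' m else v m) then
        (if ∀ m ∈ U ∩ V, w' m = v m then p w' else 0) else 0 := fun w => by
    by_cases hw : ∀ m ∈ U, w m = v m
    · rw [if_pos hw, marginal]
      refine Finset.sum_congr rfl fun w' _ => ?_
      rw [← ite_and]
      exact if_congr (by rw [← h, and_iff_right hw]) rfl rfl
    · rw [if_neg hw, Finset.sum_eq_zero]
      intro w' _
      rw [← ite_and, if_neg]
      rw [← h]
      exact fun h' => hw h'.1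
  rw [Finset.sum_congr rfl fun w _ => h1 w, Finset.sum_comm]
  simp only [Finset.sum_ite_eq', Finset.mem_univ, if_true, marginal]
  refine Finset.sum_congr rfl fun w _ => ?_
  by_cases hw : ∀ m ∈ U ∩ V, w m = v m
  · rw [if_pos hw, if_pos hw]
  · rw [if_neg hw, if_neg hw]

variable {k : ℕ} {out : Fin k ⊕ Fin k → Type v} [∀ m, Fintype (out m)]
  {p : (∀ m, out m) → ℝ}

/-- Sum the defining identity of arm `i` over all outcomes outside `U`, `aᵢ` and `xᵢ`. -/
theorem marginal_insert (hp : IsMultiarmCorrelation p) (i : Fin k) (U : Set (Fin k ⊕ Fin k))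
    (h1 : .inl i ∉ U) (h2 : .inr i ∉ U) (v : ∀ m, out m) :
    marginal p (insert (.inr i) U) v = marginal p {.inr i} v * marginal p U v := by
  classical
  -- Both `inl i` and `inr i` are held fixed: the marginals being summed do not depend on the
  -- omitted outcomes, and letting these vary would overcount.
  let W : Set (Fin k ⊕ Fin k) := insert (.inl i) (insert (.inr i) U)
  have hW1 := sum_marginal p W {.inl i}ᶜ (by ext m; simp [W]; tauto) v
  have hW2 := sum_marginal p W {.inl i, .inr i}ᶜ (by ext m; simp [W]; tauto) v
  have e1 : W ∩ {.inl i}ᶜ = insert (.inr i) U := by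
    ext m
    simp only [W, Set.mem_inter_iff, Set.mem_insert_iff, Set.mem_compl_iff, Set.mem_singleton_iff]
    refine ⟨fun h => h.1.resolve_left h.2, fun h => ⟨.inr h, ?_⟩⟩
    rintro rfl
    rcases h with h | h
    · cases h
    · exact h1 h
  have e2 : W ∩ {.inl i, .inr i}ᶜ = U := by
    ext m
    simp only [W, Set.mem_inter_iff, Set.mem_insert_iff, Set.mem_compl_iff, Set.mem_singleton_iff,
      not_or]
    refine ⟨fun h => (h.1.resolve_left h.2.1).resolve_left h.2.2, fun h => ⟨.inr (.inr h), ?_, ?_⟩⟩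
    · rintro rfl
      exact h1 h
    · rintro rfl
      exact h2 h
  rw [e1] at hW1
  rw [e2] at hW2
  rw [← hW1, ← hW2, Finset.mul_sum]
  refine Finset.sum_congr rfl fun w _ => ?_
  split_ifs with hw
  · rw [hp.2.2 i w]
    have : w (.inr i) = v (.inr i) := hw _ (by simp [W])
    simp only [marginal, Set.mem_singleton_iff, forall_eq, this]
  · simp

/-- Joint independence of the settings: `marginal_insert` splits off one setting at a time. -/
theorem marginal_image (hp : IsMultiarmCorrelation p) (s : Finset (Fin k)) (v : ∀ m, out m) :
    marginal p (Sum.inr '' (s : Set (Fin k))) v = ∏ i ∈ s, settingProb p i (v (.inr i)) := by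
  classical
  induction s using Finset.induction_on with
  | empty => simp [marginal, hp.2.1]
  | insert i s hi ih =>
    rw [Finset.coe_insert, Set.image_insert_eq, marginal_insert hp i _ (by simp)
      (by simpa using hi),
      ih, Finset.prod_insert hi]
    simp [marginal, settingProb]

theorem joint_eta (v : ∀ m, out m) : joint (fun i => v (.inl i)) (fun i => v (.inr i)) = v := by
  funext m
  cases m <;> rfl

theorem sum_eq_sum_joint [DecidableEq (Fin k)] (f : (∀ m, out m) → ℝ) :
    ∑ w, f w = ∑ x : ∀ i, out (.inr i), ∑ a : ∀ i, out (.inl i), f (joint a x) := by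
  rw [Finset.sum_comm, ← Fintype.sum_prod_type' (f := fun a x => f (joint a x)),
    ← (Equiv.sumPiEquivProdPi out).sum_comp]
  refine Finset.sum_congr rfl fun w _ => congrArg f (joint_eta w).symm

/-- The left-hand side is the marginal on all settings. The tuple `a` only supplies a complete joint
outcome at which to evaluate it. -/
theorem sum_joint (hp : IsMultiarmCorrelation p) (x : ∀ i, out (.inr i))
    (a : ∀ i, out (.inl i)) :
    ∑ a, p (joint a x) = ∏ i, settingProb p i (x i) := by
  classical
  have h := marginal_image hp Finset.univ (joint a x)
  refine Eq.trans ?_ h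
  rw [marginal, sum_eq_sum_joint]
  have h1 (y : ∀ i, out (.inr i)) (b : ∀ i, out (.inl i)) :
      (∀ m ∈ Sum.inr '' ((Finset.univ : Finset (Fin k)) : Set (Fin k)),
        joint b y m = joint a x m) ↔ x = y := by
    simp [joint, funext_iff, eq_comm]
  simp only [h1]
  simp [Finset.sum_ite_irrel]

theorem settingProb_nonneg (hp : IsMultiarmCorrelation p) (i : Fin k) (x : out (.inr i)) :
    0 ≤ settingProb p i x :=
  Finset.sum_nonneg fun w _ => by
    split_ifs
    · exact hp.1 w
    · exact le_rfl

theorem sum_settingProb (hp : IsMultiarmCorrelation p) (i : Fin k) :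
    ∑ x, settingProb p i x = 1 := by
  classical
  simp only [settingProb]
  rw [Finset.sum_comm, ← hp.2.1]
  simp

theorem le_settingProb (hp : IsMultiarmCorrelation p) (i : Fin k) (v : ∀ m, out m) :
    p v ≤ settingProb p i (v (.inr i)) := by
  classical
  have h := Finset.single_le_sum (f := fun w => if w (.inr i) = v (.inr i) then p w else 0)
    (fun w _ => by split_ifs; exacts [hp.1 w, le_rfl]) (Finset.mem_univ v)
  simpa [settingProb] using h

theorem eq_zero_of_settingProb (hp : IsMultiarmCorrelation p) (v : ∀ m, out m) (i : Fin k)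
    (h : ¬ 0 < settingProb p i (v (.inr i))) : p v = 0 :=
  le_antisymm ((le_settingProb hp i v).trans (not_lt.1 h)) (hp.1 v)

theorem eq_prod_mul_settingCond (hp : IsMultiarmCorrelation p) (v : ∀ m, out m)
    (h : ∀ i, 0 < settingProb p i (v (.inr i))) :
    p v = (∏ i, settingProb p i (v (.inr i))) *
      settingCond p (fun i => ⟨v (.inr i), h i⟩) fun i => v (.inl i) := by
  rw [settingCond, sum_joint hp _ fun i => v (.inl i), joint_eta, mul_div_cancel₀]
  exact (Finset.prod_pos fun i _ => h i).ne'

/-- If the marginal distribution of the settings factorizes as `∏ᵢ N i (xᵢ)`, then the factors do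
not vanish at settings of positive probability. -/
theorem factor_ne_zero {R : Type*} [CommSemiring R] [NoZeroDivisors R] [Nontrivial R]
    (hp : IsMultiarmCorrelation p) (c : ℝ →+* R) {N : ∀ i, out (.inr i) → R}
    (hN : ∀ x, c (∑ a, p (joint a x)) = ∏ i, N i (x i)) (i : Fin k) (x : PosSetting p i) :
    N i x.1 ≠ 0 := by
  classical
  have hx := x.2
  -- `w` is a joint outcome of positive probability with `xᵢ = x`. The settings in `w` have positive
  -- total probability, so no factor of the product there can vanish.
  obtain ⟨w, -, hw⟩ := Finset.exists_ne_zero_of_sum_ne_zero hx.ne'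
  have hwx : w (.inr i) = x.1 := by
    by_contra h
    simp [h] at hw
  rw [if_pos hwx] at hw
  have h1 : ∑ a, p (joint a fun i => w (.inr i)) ≠ 0 := by
    refine (lt_of_lt_of_le (lt_of_le_of_ne (hp.1 w) hw.symm) ?_).ne'
    have h2 := Finset.single_le_sum (f := fun a => p (joint a fun i => w (.inr i)))
      (fun a _ => hp.1 _) (Finset.mem_univ fun i => w (.inl i))
    simpa only [joint_eta] using h2
  have h3 := hN fun i => w (.inr i)
  have h4 : ∏ i, N i (w (.inr i)) ≠ 0 := by
    rw [← h3]
    exact (map_ne_zero c).2 h1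
  rw [← hwx]
  exact Finset.prod_ne_zero_iff.1 h4 i (Finset.mem_univ i)

/-- The outcomes live in universe `v`, hidden variables and Hilbert spaces in `u`; a finite copy in
`u` serves as the alphabet of an arm source. -/
theorem exists_equiv_posSetting (p : (∀ m, out m) → ℝ) (i : Fin k) :
    ∃ (X : Type u) (_ : Fintype X) (_ : DecidableEq X), Nonempty (X ≃ PosSetting p i) := by
  classical
  let _ : Fintype (PosSetting p i) := Fintype.ofFinite _
  exact ⟨ULift.{u} (Fin (Fintype.card (PosSetting p i))), inferInstance, inferInstance,
    ⟨Equiv.ulift.trans (Fintype.equivFin _).symm⟩⟩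

/-- Discarding settings of probability zero loses no mass, so these weights define a probability
measure or a unit-trace state. -/
theorem sum_settingProb_pos (hp : IsMultiarmCorrelation p) (i : Fin k) {X : Type u} [Fintype X]
    (e : X ≃ PosSetting p i) : ∑ x, settingProb p i (e x).1 = 1 := by
  classical
  let _ : Fintype (PosSetting p i) := Fintype.ofFinite _
  rw [e.sum_comp fun y => settingProb p i y.1, ← sum_settingProb hp i,
    ← Finset.sum_filter_of_ne (p := fun x => 0 < settingProb p i x)
      fun x _ hx => lt_of_le_of_ne (settingProb_nonneg hp i x) hx.symm]
  exact (Finset.sum_subtype _ (by simp) fun x => settingProb p i x).symm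

end Settings

/-! ### Classical correlations -/

section Classical

open MeasureTheory

/-! ### Separating the central hidden variable from those of the arms -/

section Fubini

variable {k : ℕ} {Ω : Option (Fin k) → Type u} [∀ s, MeasurableSpace (Ω s)]

/-- A family of hidden variables from those of the source `none` and of the sources `some i`. -/
def consOption (q : Ω none × ∀ i, Ω (some i)) : ∀ s, Ω s
  | none => q.1
  | some i => q.2 i

theorem measurable_consOption : Measurable (consOption (Ω := Ω)) :=
  measurable_pi_iff.2 fun s => match s with
    | none => measurable_fst
    | some i => (measurable_pi_apply i).comp measurable_snd

/-- The product measure is determined by its values on boxes, whose preimages are again boxes. -/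
theorem map_consOption (P : ∀ s, Measure (Ω s)) [∀ s, IsProbabilityMeasure (P s)] :
    ((P none).prod (Measure.pi fun i => P (some i))).map consOption = Measure.pi P := by
  refine (Measure.pi_eq fun s hs => ?_).symm
  rw [Measure.map_apply measurable_consOption (MeasurableSet.univ_pi hs), Fintype.prod_option,
    ← Measure.pi_pi, ← Measure.prod_prod]
  congr 1
  ext q
  simp only [Set.mem_preimage, Set.mem_pi, Set.mem_univ, true_implies, Set.mem_prod]
  exact Option.forall

theorem integral_pi_option (P : ∀ s, Measure (Ω s)) [∀ s, IsProbabilityMeasure (P s)]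
    (f : (∀ s, Ω s) → ℝ) (hf : Measurable f) (h0 : ∀ ω, 0 ≤ f ω) (h1 : ∀ ω, f ω ≤ 1) :
    ∫ ω, f ω ∂Measure.pi P =
      ∫ l, ∫ m, f (consOption (l, m)) ∂(Measure.pi fun i => P (some i)) ∂(P none) := by
  rw [← map_consOption, integral_map measurable_consOption.aemeasurable hf.aestronglyMeasurable,
    integral_prod]
  refine Integrable.of_bound (hf.comp measurable_consOption).aestronglyMeasurable 1
    (.of_forall fun q => ?_)
  rw [Real.norm_eq_abs, abs_of_nonneg (h0 _)]
  exact h1 _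

end Fubini

theorem IsCondDist.le_one {Ω : Type u} [MeasurableSpace Ω] {O : Type v} [Fintype O]
    {q : O → Ω → ℝ} (hq : IsCondDist q) (o : O) (ω : Ω) : q o ω ≤ 1 := by
  rw [← hq.2.2 ω]
  exact Finset.single_le_sum (f := fun o => q o ω) (fun o _ => hq.2.1 o ω) (Finset.mem_univ o)

variable {k : ℕ} {out : Fin k ⊕ Fin k → Type v} [∀ m, Fintype (out m)] {p : (∀ m, out m) → ℝ}

/-- The unnormalized local responses of a classical multiarm model to the hidden variable of the
source `none`. -/
theorem exists_responses (h : (multiarm k).IsClassical.{u} p) :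
    ∃ (Ω : Type u) (_ : MeasurableSpace Ω) (P : Measure Ω) (_ : IsProbabilityMeasure P)
      (r : ∀ i, out (.inr i) → out (.inl i) → Ω → ℝ) (N : ∀ i, out (.inr i) → ℝ),
      (∀ i x a, Measurable (r i x a)) ∧ (∀ i x a l, 0 ≤ r i x a l) ∧
      (∀ i x a l, r i x a l ≤ 1) ∧ (∀ i x, 0 ≤ N i x) ∧ (∀ i x l, ∑ a, r i x a l = N i x) ∧
      ∀ a x, p (joint a x) = ∫ l, ∏ i, r i (x i) (a i) l ∂P := by
  obtain ⟨Ω, _, P, _, q, hq, hp⟩ := h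
  let ext₁ (i : Fin k) (t : Ω none × Ω (some i)) :
      ∀ s : {s // (multiarm k).connects s (.inl i)}, Ω s.1 := fun s => match s with
    | ⟨none, _⟩ => t.1
    | ⟨some _, rfl⟩ => t.2
  let ext₂ (i : Fin k) (m : Ω (some i)) :
      ∀ s : {s // (multiarm k).connects s (.inr i)}, Ω s.1 := fun s => match s with
    | ⟨some _, rfl⟩ => m
  have hm₁ (i : Fin k) : Measurable (ext₁ i) := measurable_pi_iff.2 fun s => match s with
    | ⟨none, _⟩ => measurable_fst
    | ⟨some _, rfl⟩ => measurable_snd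
  have hm₂ (i : Fin k) : Measurable (ext₂ i) := measurable_pi_iff.2 fun s => match s with
    | ⟨some _, rfl⟩ => measurable_id
  have he₁ (i : Fin k) (ω : ∀ s, Ω s) : (fun s : {s // (multiarm k).connects s (.inl i)} => ω s.1) =
      ext₁ i (ω none, ω (some i)) := funext fun s => match s with
    | ⟨none, _⟩ => rfl
    | ⟨some _, rfl⟩ => rfl
  have he₂ (i : Fin k) (ω : ∀ s, Ω s) : (fun s : {s // (multiarm k).connects s (.inr i)} => ω s.1) =
      ext₂ i (ω (some i)) := funext fun s => match s with
    | ⟨some _, rfl⟩ => rfl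
  let g (i : Fin k) (x : out (.inr i)) (a : out (.inl i)) (t : Ω none × Ω (some i)) : ℝ :=
    q (.inl i) a (ext₁ i t) * q (.inr i) x (ext₂ i t.2)
  have hg (i : Fin k) (x : out (.inr i)) (a : out (.inl i)) : Measurable (g i x a) :=
    (((hq _).1 a).comp (hm₁ i)).mul (((hq _).1 x).comp ((hm₂ i).comp measurable_snd))
  have hg0 (i : Fin k) (x : out (.inr i)) (a : out (.inl i)) (t) : 0 ≤ g i x a t :=
    mul_nonneg ((hq _).2.1 _ _) ((hq _).2.1 _ _)
  have hg1 (i : Fin k) (x : out (.inr i)) (a : out (.inl i)) (t) : g i x a t ≤ 1 :=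
    mul_le_one₀ ((hq _).le_one _ _) ((hq _).2.1 _ _) ((hq _).le_one _ _)
  have hint (i : Fin k) (x : out (.inr i)) (a : out (.inl i)) (l : Ω none) :
      Integrable (fun m => g i x a (l, m)) (P (some i)) :=
    Integrable.of_bound ((hg i x a).comp measurable_prodMk_left).aestronglyMeasurable 1
      (.of_forall fun m => by
        rw [Real.norm_eq_abs, abs_of_nonneg (hg0 _ _ _ _)]
        exact hg1 _ _ _ _)
  refine ⟨Ω none, inferInstance, P none, inferInstance,
    fun i x a l => ∫ m, g i x a (l, m) ∂(P (some i)),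
    fun i x => ∫ m, q (.inr i) x (ext₂ i m) ∂(P (some i)), fun i x a => ?_, fun i x a l => ?_,
    fun i x a l => ?_, fun i x => ?_, fun i x l => ?_, fun a x => ?_⟩
  · exact (hg i x a).stronglyMeasurable.integral_prod_right.measurable
  · exact integral_nonneg fun m => hg0 _ _ _ _
  · refine (integral_mono (hint i x a l) (integrable_const 1) fun m => hg1 _ _ _ _).trans ?_
    simp
  · exact integral_nonneg fun m => (hq _).2.1 _ _
  -- Summing over `a` removes the response of `inl i`; the response of `inr i` does not involve `l`.
  · rw [← integral_finsetSum _ fun a _ => hint i x a l]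
    refine integral_congr_ae (.of_forall fun m => ?_)
    simp only [g, ← Finset.sum_mul, (hq (.inl i)).2.2, one_mul]
  · have hpr (ω : ∀ s, Ω s) : ∏ m, q m (joint a x m) (fun s => ω s.1) =
        ∏ i, g i (x i) (a i) (ω none, ω (some i)) := by
      rw [Fintype.prod_sum_type, ← Finset.prod_mul_distrib]
      refine Finset.prod_congr rfl fun i _ => ?_
      rw [he₁, he₂]
      rfl
    rw [hp]
    simp only [hpr]
    rw [integral_pi_option]
    · refine integral_congr_ae (.of_forall fun l => ?_)
      -- For fixed `l` the arm variables are independent, so the integral of the product splits arm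
      -- by arm.
      exact integral_fintype_prod_eq_prod (μ := fun i => P (some i))
        fun i m => g i (x i) (a i) (l, m)
    · exact Finset.measurable_prod _ fun i _ => (hg i _ _).comp
        ((measurable_pi_apply none).prodMk (measurable_pi_apply (some i)))
    · exact fun ω => Finset.prod_nonneg fun i _ => hg0 _ _ _ _
    · exact fun ω => Finset.prod_le_one (fun i _ => hg0 _ _ _ _) fun i _ => hg1 _ _ _ _

/-- Divide the responses by their constant totals `N i x`; since `∏ᵢ N i (xᵢ) = p(x)`, this is
exactly conditioning on the settings. -/
theorem isBellClassical_of_isClassical (hp : IsMultiarmCorrelation p)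
    (h : (multiarm k).IsClassical.{u} p) : IsBellClassical.{u} (settingCond p) := by
  classical
  obtain ⟨Ω, _, P, _, r, N, hr, hr0, hr1, hN0, hN, hpr⟩ := exists_responses h
  have hsum (x : ∀ i, out (.inr i)) : ∑ a, p (joint a x) = ∏ i, N i (x i) := by
    simp only [hpr]
    rw [← integral_finsetSum]
    · have h1 (l : Ω) : ∑ a : ∀ i, out (.inl i), ∏ i, r i (x i) (a i) l = ∏ i, N i (x i) := by
        simp only [← hN _ _ l]
        rw [Finset.prod_univ_sum, Fintype.piFinset_univ]
      simp only [h1]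
      simp
    · refine fun a _ => Integrable.of_bound
        (Finset.measurable_prod _ fun i _ => hr i _ _).aestronglyMeasurable 1
        (.of_forall fun l => ?_)
      rw [Real.norm_eq_abs, abs_of_nonneg (Finset.prod_nonneg fun i _ => hr0 _ _ _ _)]
      exact Finset.prod_le_one (fun i _ => hr0 _ _ _ _) fun i _ => hr1 _ _ _ _
  have hne := factor_ne_zero hp (RingHom.id ℝ) (N := N) hsum
  refine ⟨Ω, inferInstance, P, inferInstance, fun i x a l => r i x.1 a l / N i x.1,
    fun i x => ⟨fun a => (hr i x.1 a).div_const _, fun a l => div_nonneg (hr0 _ _ _ _) (hN0 _ _),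
      fun l => ?_⟩, fun x a => ?_⟩
  · rw [← Finset.sum_div, hN, div_self (hne i x)]
  · simp only [Finset.prod_div_distrib]
    rw [integral_div, ← hpr, ← hsum, settingCond]

/-- The probability measure with weights `w x` on a finite type. -/
def weightMeasure {X : Type u} [Fintype X] (w : X → ℝ) : @Measure X ⊤ :=
  ∑ x, ENNReal.ofReal (w x) • @Measure.dirac X ⊤ x

theorem isProbabilityMeasure_weightMeasure {X : Type u} [Fintype X] {w : X → ℝ}
    (hw : ∀ x, 0 ≤ w x) (hw' : ∑ x, w x = 1) : @IsProbabilityMeasure X ⊤ (weightMeasure w) := by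
  let _ : MeasurableSpace X := ⊤
  refine ⟨?_⟩
  simp [weightMeasure, ← ENNReal.ofReal_sum_of_nonneg fun x _ => hw x, hw']

theorem integral_weightMeasure {X : Type u} [Fintype X] [DecidableEq X] {w : X → ℝ}
    (hw : ∀ x, 0 ≤ w x) (y : X) :
    @integral X ℝ _ _ ⊤ (weightMeasure w) (fun x => if x = y then 1 else 0) = w y := by
  let _ : MeasurableSpace X := ⊤
  rw [weightMeasure, integral_finsetSum_measure]
  · simp only [integral_smul_measure, integral_dirac]
    simp [ENNReal.toReal_ofReal (hw _)]
  · exact fun x _ => (integrable_dirac (by simp)).smul_measure ENNReal.ofReal_ne_top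

theorem measurable_of_countable_fst {X Y : Type*} [Countable X] [MeasurableSpace Y]
    {f : X → Y → ℝ} (hf : ∀ x, Measurable (f x)) :
    @Measurable (X × Y) ℝ (@Prod.instMeasurableSpace X Y ⊤ _) _ fun t => f t.1 t.2 := by
  let _ : MeasurableSpace X := ⊤
  exact measurable_from_prod_countable_right hf

/-- The arm sources draw the settings independently with their probabilities under `p`, and the
central source keeps the Bell hidden variable. -/
theorem isClassical_of_isBellClassical (hp : IsMultiarmCorrelation p)
    (h : IsBellClassical.{u} (settingCond p)) : (multiarm k).IsClassical.{u} p := by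
  classical
  obtain ⟨Ω₀, m₀, P₀, _, q, hq, hc⟩ := h
  choose X _ _ e using exists_equiv_posSetting.{u} p
  replace e := fun i => (e i).some
  let Ω : Option (Fin k) → Type u := fun s => match s with
    | none => Ω₀
    | some i => X i
  let mΩ : ∀ s, MeasurableSpace (Ω s) := fun s => match s with
    | none => m₀
    | some _ => ⊤
  let P : ∀ s, Measure (Ω s) := fun s => match s with
    | none => P₀
    | some i => weightMeasure fun x : X i => settingProb p i (e i x).1
  have hP : ∀ s, IsProbabilityMeasure (P s) := fun s => match s with
    | none => inferInstanceAs (IsProbabilityMeasure P₀)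
    | some i => isProbabilityMeasure_weightMeasure (fun x => (e i x).2.le)
      (sum_settingProb_pos hp i (e i))
  let Q : ∀ m, out m → (∀ s : {s // (multiarm k).connects s m}, Ω s.1) → ℝ := fun m => match m with
    | .inl i => fun a ω => q i (e i (ω ⟨some i, rfl⟩)) a (ω ⟨none, trivial⟩)
    | .inr i => fun y ω => if (e i (ω ⟨some i, rfl⟩)).1 = y then 1 else 0
  refine ⟨Ω, mΩ, P, hP, Q, fun m => match m with
    | .inl i => ⟨fun a => ?_, fun a ω => (hq i _).2.1 a _, fun ω => (hq i _).2.2 _⟩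
    | .inr i => ⟨fun y => ?_, fun y ω => ?_, fun ω => ?_⟩, fun v => ?_⟩
  · have h1 : @Measurable (∀ s : {s // (multiarm k).connects s (.inl i)}, Ω s.1) (X i × Ω₀) _
        (@Prod.instMeasurableSpace (X i) Ω₀ ⊤ m₀) fun ω => (ω ⟨some i, rfl⟩, ω ⟨none, trivial⟩) :=
      (measurable_pi_apply _).prodMk (measurable_pi_apply _)
    exact (measurable_of_countable_fst fun x => (hq i (e i x)).1 a).comp h1
  · exact (measurable_from_top (f := fun x : X i => if (e i x).1 = y then (1 : ℝ) else 0)).comp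
      (measurable_pi_apply (⟨some i, rfl⟩ : {s // (multiarm k).connects s (.inr i)}))
  · simp only [Q]
    split_ifs
    exacts [zero_le_one, le_rfl]
  · simp [Q]
  · by_cases hv : ∀ i, 0 < settingProb p i (v (.inr i))
    · let y (i : Fin k) : PosSetting p i := ⟨v (.inr i), hv i⟩
      -- Announcing the prescribed value forces each arm variable, so the Bell responses may be
      -- evaluated at the fixed settings and the integrand becomes a product over sources.
      let f : ∀ s, Ω s → ℝ := fun s => match s with
        | none => fun l => ∏ i, q i (y i) (v (.inl i)) l
        | some i => fun x : X i => if x = (e i).symm (y i) then 1 else 0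
      have h1 (ω : ∀ s, Ω s) : ∏ m, Q m (v m) (fun s => ω s.1) = ∏ s, f s (ω s) := by
        rw [Fintype.prod_sum_type, Fintype.prod_option, ← Finset.prod_mul_distrib,
          ← Finset.prod_mul_distrib]
        refine Finset.prod_congr rfl fun i _ => ?_
        simp only [Q, f, Equiv.eq_symm_apply, mul_ite, mul_one, mul_zero]
        refine ite_congr (by rw [Subtype.ext_iff]) (fun h => ?_) fun _ => rfl
        rw [show e i (ω (some i)) = y i from h]
      simp only [h1]
      rw [integral_fintype_prod_eq_prod, Fintype.prod_option, eq_prod_mul_settingCond hp v hv,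
        hc, mul_comm]
      congr 1
      refine Finset.prod_congr rfl fun i _ => ?_
      refine Eq.trans ?_ (integral_weightMeasure (w := fun x => settingProb p i (e i x).1)
        (fun x => (e i x).2.le) ((e i).symm (y i))).symm
      simp [y]
    -- A setting of probability zero is never drawn, so its announcement has response zero, and `p`
    -- vanishes there as well.
    · push Not at hv
      obtain ⟨i, hi⟩ := hv
      have h1 (ω : ∀ s, Ω s) : ∏ m, Q m (v m) (fun s => ω s.1) = 0 := by
        refine Finset.prod_eq_zero (Finset.mem_univ (.inr i)) ?_
        refine if_neg fun h => ?_
        exact hi.not_gt (h ▸ (e i (ω (some i))).2)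
      simp only [h1, integral_zero]
      exact eq_zero_of_settingProb hp v i hi.not_gt

end Classical

/-! ### Quantum correlations -/

section Quantum

open HilbertTensor InnerProductSpace CorrelationScenario

/-- The connections of a scenario form a finite type. -/
abbrev CorrelationScenario.fintypeConn (G : CorrelationScenario) : Fintype G.Conn := inferInstance

instance (k : ℕ) : Fintype (multiarm k).Conn := fintypeConn (multiarm k)

/-- The connections of the multiarm scenario. -/
def multiarmSystem (k : ℕ) : ArmSystem (Conn.src (multiarm k)) (Conn.meas (multiarm k)) where
  conn₀ i := ⟨(none, .inl i), trivial⟩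
  conn₁ i := ⟨(some i, .inl i), rfl⟩
  conn₂ i := ⟨(some i, .inr i), rfl⟩
  src_conn₀ _ := rfl
  src_conn₁ _ := rfl
  src_conn₂ _ := rfl
  meas_conn₀ _ := rfl
  meas_conn₁ _ := rfl
  meas_conn₂ _ := rfl
  exists_eq
    | ⟨(none, .inl i), _⟩ => ⟨i, .inl rfl⟩
    | ⟨(some i, .inl _), rfl⟩ => ⟨i, .inr (.inl rfl)⟩
    | ⟨(some i, .inr _), rfl⟩ => ⟨i, .inr (.inr rfl)⟩

/-! ### Linearity of the trace against a state -/

section Trace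

variable {K : Type u} [NormedAddCommGroup K] [InnerProductSpace ℂ K] [CompleteSpace K]

theorem IsState.opTrace_smul {ρ : K →L[ℂ] K} (h : IsState ρ) (c : ℂ) (T : K →L[ℂ] K) :
    opTrace (ρ ∘L (c • T)) = c * opTrace (ρ ∘L T) := by
  obtain ⟨α, ξ, hξ⟩ := h.exists_isEnsemble
  refine (hξ.hasSum_opTrace (c • T)).unique (((hξ.hasSum_opTrace T).mul_left c).congr_fun
    fun n => ?_)
  rw [smul_apply, inner_smul_right]

theorem IsState.opTrace_sum {ρ : K →L[ℂ] K} (h : IsState ρ) {J : Type*} [Fintype J]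
    (T : J → K →L[ℂ] K) : opTrace (ρ ∘L ∑ j, T j) = ∑ j, opTrace (ρ ∘L T j) := by
  obtain ⟨α, ξ, hξ⟩ := h.exists_isEnsemble
  refine (hξ.hasSum_opTrace _).unique
    ((hasSum_sum fun j (_ : j ∈ Finset.univ) => hξ.hasSum_opTrace (T j)).congr_fun fun n => ?_)
  rw [sum_apply, inner_sum]

theorem IsState.opTrace_one {ρ : K →L[ℂ] K} (h : IsState ρ) : opTrace (ρ ∘L 1) = 1 :=
  h.2.tsum_eq

end Trace

variable {k : ℕ}

theorem HilbertTensor.sum_map {A : Fin k → Type v} [∀ i, Fintype (A i)] {H : Fin k → Type u}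
    [∀ i, NormedAddCommGroup (H i)] [∀ i, InnerProductSpace ℂ (H i)]
    (B : ∀ i, A i → H i →L[ℂ] H i) :
    ∑ a : ∀ i, A i, map (fun i => B i (a i)) = map fun i => ∑ a, B i a := by
  classical
  refine ext_inner fun x y => ?_
  rw [sum_apply, inner_sum, inner_map_tprod]
  simp only [inner_map_tprod, sum_apply, inner_sum]
  rw [Finset.prod_univ_sum, Fintype.piFinset_univ]

variable {out : Fin k ⊕ Fin k → Type v} [∀ m, Fintype (out m)] {p : (∀ m, out m) → ℝ}

/-- The effective operators of an arm sum to `N i x` times the identity. Dividing by `N i x` gives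
POVMs, and multilinearity turns these scalars into the factor `1 / p(x)`. -/
theorem isBellQuantum_of_isQuantum (hp : IsMultiarmCorrelation p)
    (h : (multiarm k).IsQuantum.{u} p) : IsBellQuantum.{u} (settingCond p) := by
  classical
  obtain ⟨H, _, _, _, ρ, F, hρ, hF, hpr⟩ := h
  obtain ⟨σ, B, N, hσ, hB, hN0, hN, hBr⟩ := (multiarmSystem k).exists_effective (O := out) ρ hρ F hF
  have hpB (a : ∀ i, out (.inl i)) (x : ∀ i, out (.inr i)) :
      (p (joint a x) : ℂ) = opTrace (σ ∘L map fun i => B i (x i) (a i)) :=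
    (hpr (joint a x)).trans (hBr (joint a x))
  have hsum (x : ∀ i, out (.inr i)) :
      Complex.ofRealHom (∑ a, p (joint a x)) = ∏ i, (N i (x i) : ℂ) := by
    rw [map_sum]
    refine (Finset.sum_congr rfl fun a _ => hpB a x).trans ?_
    rw [← hσ.opTrace_sum, sum_map (fun i a => B i (x i) a)]
    simp only [hN]
    rw [HilbertTensor.map_smul, HilbertTensor.map_one, hσ.opTrace_smul, hσ.opTrace_one, mul_one]
  have hne := factor_ne_zero hp Complex.ofRealHom (N := fun i x => (N i x : ℂ)) hsum
  refine ⟨(multiarmSystem k).Local H, inferInstance, inferInstance, inferInstance, σ,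
    fun i x a => (N i x.1 : ℂ)⁻¹ • B i x.1 a, hσ, fun i x => ⟨fun a => ?_, ?_⟩, fun x a => ?_⟩
  · refine (hB i x.1 a).smul_of_nonneg ?_
    rw [← Complex.ofReal_inv]
    exact Complex.zero_le_real.2 (inv_nonneg.2 (hN0 _ _))
  · rw [← Finset.smul_sum, hN, smul_smul, inv_mul_cancel₀ (hne i x), one_smul]
  · rw [HilbertTensor.map_smul, hσ.opTrace_smul, ← hpB, settingCond, Complex.ofReal_div,
      Finset.prod_inv_distrib, ← hsum, div_eq_inv_mul]
    rfl

/-- A Hilbert space. -/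
structure HilbertSpaceData where
  carrier : Type u
  [normedAddCommGroup : NormedAddCommGroup carrier]
  [innerProductSpace : InnerProductSpace ℂ carrier]
  [completeSpace : CompleteSpace carrier]

namespace HilbertSpaceData

attribute [instance] normedAddCommGroup innerProductSpace completeSpace

end HilbertSpaceData

/-- The Hilbert spaces of the multiarm model obtained from a model in the Bell scenario. -/
def bellSpace (Hb : Fin k → HilbertSpaceData.{u}) (X : Fin k → Type u) [∀ i, Fintype (X i)] :
    (multiarm k).Conn → HilbertSpaceData.{u}
  | ⟨(none, .inl i), _⟩ => Hb i
  | ⟨(some i, _), _⟩ => ⟨EuclideanSpace ℂ (X i)⟩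

/-- The arm systems are `ℂ^X` with its standard basis, where `X` enumerates the settings of positive
probability, and the weights are their probabilities. -/
theorem isQuantum_of_isBellQuantum (hp : IsMultiarmCorrelation p)
    (h : IsBellQuantum.{u} (settingCond p)) : (multiarm k).IsQuantum.{u} p := by
  classical
  obtain ⟨Hb, _, _, _, ρ, F, hρ, hF, hc⟩ := h
  choose X _ _ e using exists_equiv_posSetting.{u} p
  replace e := fun i => (e i).some
  let H (c : (multiarm k).Conn) : Type u := (bellSpace (fun i => ⟨Hb i⟩) X c).carrier
  let e₁ (i : Fin k) : OrthonormalBasis (X i) ℂ (H ((multiarmSystem k).conn₁ i)) :=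
    EuclideanSpace.basisFun (X i) ℂ
  let e₂ (i : Fin k) : OrthonormalBasis (X i) ℂ (H ((multiarmSystem k).conn₂ i)) :=
    EuclideanSpace.basisFun (X i) ℂ
  have hw (i : Fin k) (x : X i) : 0 ≤ settingProb p i (e i x).1 := (e i x).2.le
  refine ⟨H, inferInstance, inferInstance, inferInstance,
    (multiarmSystem k).bellStates e₁ e₂ ρ fun i x => settingProb p i (e i x).1,
    (multiarmSystem k).bellPOVMs e₁ e₂ (O := out) (fun i x => F i (e i x)) fun i x => (e i x).1,
    (multiarmSystem k).isState_bellStates e₁ e₂ hρ hw fun i => sum_settingProb_pos hp i (e i),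
    (multiarmSystem k).isPOVM_bellPOVMs e₁ e₂ _ _ fun i x => hF i (e i x), fun v => ?_⟩
  refine Eq.trans ?_ ((multiarmSystem k).opTrace_bell e₁ e₂ (fun i x => F i (e i x))
    (fun i x => (e i x).1) hρ hw v).symm
  by_cases hv : ∀ i, 0 < settingProb p i (v (.inr i))
  · have h1 (i : Fin k) : (∑ x, if (e i x).1 = v (.inr i) then
        (settingProb p i (e i x).1 : ℂ) • F i (e i x) (v (.inl i)) else 0) =
        (settingProb p i (v (.inr i)) : ℂ) • F i ⟨v (.inr i), hv i⟩ (v (.inl i)) := by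
      rw [Finset.sum_eq_single ((e i).symm ⟨v (.inr i), hv i⟩)]
      · rw [Equiv.apply_symm_apply, if_pos rfl]
      · exact fun x _ hx => if_neg fun h => hx ((Equiv.eq_symm_apply _).2 (Subtype.ext h))
      · exact fun h => absurd (Finset.mem_univ _) h
    refine Eq.trans ?_ (congrArg (fun T => opTrace (ρ ∘L map T)) (funext h1)).symm
    rw [HilbertTensor.map_smul, hρ.opTrace_smul, ← hc, eq_prod_mul_settingCond hp v hv]
    push_cast
    rfl
  · push Not at hv
    obtain ⟨i, hi⟩ := hv
    have h1 (x : X i) : (e i x).1 ≠ v (.inr i) := fun h => hi.not_gt (h ▸ (e i x).2)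
    -- At a setting of probability zero the operator of one arm is an empty sum, which kills the
    -- whole tensor product.
    have h2 : (map fun i => ∑ x, if (e i x).1 = v (.inr i) then
        (settingProb p i (e i x).1 : ℂ) • F i (e i x) (v (.inl i)) else 0) = 0 := by
      refine ext_inner fun x y => ?_
      rw [inner_map_tprod, Finset.prod_eq_zero (Finset.mem_univ i)]
      · simp
      · simp [h1]
    refine Eq.trans ?_ (congrArg (fun T => opTrace (ρ ∘L T)) h2).symm
    rw [eq_zero_of_settingProb hp v i hi.not_gt]
    simp [opTrace]

end Quantum

theorem mainTheorem7 (k : ℕ) (out : Fin k ⊕ Fin k → Type v) [∀ m, Fintype (out m)]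
    (p : (∀ m, out m) → ℝ) (hp : IsMultiarmCorrelation p) :
    ((multiarm k).IsClassical.{u} p ↔ IsBellClassical.{u} (settingCond p)) ∧
    ((multiarm k).IsQuantum.{u} p ↔ IsBellQuantum.{u} (settingCond p)) :=
  ⟨⟨isBellClassical_of_isClassical hp, isClassical_of_isBellClassical hp⟩,
    ⟨isBellQuantum_of_isQuantum hp, isQuantum_of_isBellQuantum hp⟩⟩

end
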